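/- Let $0<R_1<R_2$, let $\rho=\sqrt{x^2+y^2}$, $\Omega=\{(x,y,z)\in\mathbb R^3:\ R_1<\rho<R_2\}$, and let $\Gamma_1=\{\rho=R_1\}$, $\Gamma_2=\{\rho=R_2\}$ be the inner and the outer cylinder. Let $V_0(\Omega)=\{v\in H^1_0(\Omega)^3:\ \nabla\cdot v=0 \text{ in }\Omega\}$ and $$\Lambda(\Omega)=\inf_{v\in V_0(\Omega)\setminus\{0\}}\frac{\|\nabla v\|^2_{L^2(\Omega)}}{\|v\|^2_{L^2(\Omega)}}.$$ With $e_\theta=(-y/\rho,x/\rho,0)$ and $e_z=(0,0,1)$, define for $\alpha,\beta\in\mathbb R$ the spiral Poiseuille flow $$\widetilde{\mathcal U}_{\alpha,\beta}=\alpha\,\frac{R_2}{R_2^2-R_1^2}\Big(\rho-\frac{R_1^2}{\rho}\Big)e_\theta+\frac{\beta}{4}\Big(\rho^2-R_1^2-\frac{R_2^2-R_1^2}{\log(R_2/R_1)}\log\frac{\rho}{R_1}\Big)e_z,$$ $$\widetilde{\mathcal P}_{\alpha,\beta}=\frac{\alpha^2}{2}\Big[\frac{R_2}{R_2^2-R_1^2}\Big]^2\Big(\rho^2-\frac{R_1^4}{\rho^2}-4R_1^2\log\rho\Big)+\beta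 z,$$ and the constant $$M_{\rm in}(\alpha,\beta)=\left[\alpha^2\frac{R_2^2}{(R_2^2-R_1^2)^2}+\frac{\beta^2}{16}\Big(\frac{R_2^2-R_1^2}{R_1\log(R_2^2/R_1^2)}-R_1\Big)^2\right]^{1/2}.$$ **Theorem.** Fix $\alpha,\beta\in\mathbb R$. Assume that $(v,q)\in V_0(\Omega)\times L^2(\Omega)$ is such that $(u,p)=(\widetilde{\mathcal U}_{\alpha,\beta}+v,\ \widetilde{\mathcal P}_{\alpha,\beta}+q)$ is a solution of the stationary Navier–Stokes problem $$-\Delta u+(u\cdot\nabla)u+\nabla p=0,\qquad \nabla\cdot u=0\quad\text{in }\Omega,\qquad u=0\ \text{ on }\Gamma_1,\qquad u=\alpha\,e_\theta\ \text{ on }\Gamma_2,$$ where the equations are understood in the weak sense (tested against $C_c^\infty(\Omega)$) and the boundary conditions in the sense of traces; in particular, classical solutions are included. If $M_{\rm in}(\alpha,\beta)<\Lambda(\Omega)$, then $v=0$ and $q=0$ almost everywhere in $\Omega$. -/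

import Mathlib

open MeasureTheory Filter Topology
open scoped ContDiff

noncomputable section

namespace CouettePoiseuille

/-- Three-dimensional Euclidean space, with Cartesian coordinates `(x 0, x 1, x 2) = (x, y, z)`. -/
abbrev E3 : Type := EuclideanSpace ℝ (Fin 3)

/-- The distance to the `z`-axis. -/
def rho (x : E3) : ℝ := Real.sqrt (x 0 ^ 2 + x 1 ^ 2)

/-- The region between two infinite coaxial cylinders of radii `R1` and `R2`. -/
def annulus (R1 R2 : ℝ) : Set E3 := {x | R1 < rho x ∧ rho x < R2}

/-- The infinite cylindrical surface of radius `R`. -/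
def cylinder (R : ℝ) : Set E3 := {x | rho x = R}

/-- The azimuthal unit vector. -/
def eTheta (x : E3) : E3 := !₂[-(x 1) / rho x, x 0 / rho x, 0]

/-- The vertical unit vector. -/
def eZ : E3 := !₂[0, 0, 1]

/-! ### Sobolev spaces -/

/-- The classical partial derivative in the `j`-th Cartesian direction. -/
def pderiv (j : Fin 3) (f : E3 → ℝ) (x : E3) : ℝ :=
  fderiv ℝ f x (EuclideanSpace.single j 1)

/-- Real test functions on `Ω`, i.e. elements of `C_c^∞(Ω)`. -/
structure IsTest (Ω : Set E3) (φ : E3 → ℝ) : Prop where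
  smooth : ContDiff ℝ ∞ φ
  compact : HasCompactSupport φ
  support : tsupport φ ⊆ Ω

/-- `g` is the weak (distributional) `j`-th partial derivative of `f` in `Ω`. -/
structure IsWeakPartial (Ω : Set E3) (j : Fin 3) (f g : E3 → ℝ) : Prop where
  locInt : LocallyIntegrableOn f Ω
  locInt_deriv : LocallyIntegrableOn g Ω
  byParts : ∀ φ : E3 → ℝ, IsTest Ω φ →
    ∫ x in Ω, f x * pderiv j φ x = -∫ x in Ω, g x * φ x

/-- `f ∈ L²(Ω)`. -/
def MemL2 (Ω : Set E3) (f : E3 → ℝ) : Prop := MemLp f 2 (volume.restrict Ω)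

/-- `f ∈ L²_loc(Ω)`. -/
def MemL2Loc (Ω : Set E3) (f : E3 → ℝ) : Prop := ∀ K : Set E3, IsCompact K → K ⊆ Ω → MemL2 K f

/-- `f ∈ H¹₀(Ω)` with weak gradient `g`: both are square integrable and `f` is a limit of
test functions on `Ω` in the norm of `H¹(Ω)`. -/
structure IsH10 (Ω : Set E3) (f : E3 → ℝ) (g : Fin 3 → E3 → ℝ) : Prop where
  memL2 : MemL2 Ω f
  memL2_grad : ∀ j, MemL2 Ω (g j)
  weak : ∀ j, IsWeakPartial Ω j f (g j)
  approx : ∃ φ : ℕ → E3 → ℝ, (∀ n, IsTest Ω (φ n)) ∧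
    Tendsto (fun n => eLpNorm (fun x => φ n x - f x) 2 (volume.restrict Ω)) atTop (𝓝 0) ∧
    ∀ j, Tendsto (fun n => eLpNorm (fun x => pderiv j (φ n) x - g j x) 2 (volume.restrict Ω))
      atTop (𝓝 0)

/-- `v ∈ V₀(Ω)` with weak gradient `G`, where `G i j = ∂_j v_i`: all the components of `v` are in
`H¹₀(Ω)`, and `v` is divergence free. -/
structure IsV0 (Ω : Set E3) (v : E3 → E3) (G : Fin 3 → Fin 3 → E3 → ℝ) : Prop where
  h10 : ∀ i, IsH10 Ω (fun x => v x i) (G i)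
  divFree : ∀ᵐ x ∂(volume.restrict Ω), ∑ i, G i i x = 0

/-- `v ∈ V₀(Ω)`. -/
def MemV0 (Ω : Set E3) (v : E3 → E3) : Prop := ∃ G, IsV0 Ω v G

/-- The Poincaré constant: the infimum of `‖∇v‖² / ‖v‖²` (squared norms of `L²(Ω)`) over the
nonzero `v ∈ V₀(Ω)`. -/
def Lambda (Ω : Set E3) : ℝ :=
  sInf {r : ℝ | ∃ (v : E3 → E3) (G : Fin 3 → Fin 3 → E3 → ℝ), IsV0 Ω v G ∧
    ¬ (v =ᵐ[volume.restrict Ω] 0) ∧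
    r = (∫ x in Ω, ∑ i, ∑ j, G i j x ^ 2) / ∫ x in Ω, ‖v x‖ ^ 2}

/-! ### The explicit flows with still inner cylinder -/

/-- Azimuthal profile of the Couette flow (inner cylinder still, outer one rotating). -/
def couetteU (R1 R2 r : ℝ) : ℝ := R2 / (R2 ^ 2 - R1 ^ 2) * (r - R1 ^ 2 / r)

/-- Pressure profile of the Couette flow (inner cylinder still, outer one rotating). -/
def couetteP (R1 R2 r : ℝ) : ℝ :=
  1 / 2 * (R2 / (R2 ^ 2 - R1 ^ 2)) ^ 2 * (r ^ 2 - R1 ^ 4 / r ^ 2 - 4 * R1 ^ 2 * Real.log r)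

/-- The circular Poiseuille function. -/
def poiseuilleU (R1 R2 r : ℝ) : ℝ :=
  1 / 4 * (r ^ 2 - R1 ^ 2 - (R2 ^ 2 - R1 ^ 2) / Real.log (R2 / R1) * Real.log (r / R1))

/-- Velocity of the spiral Poiseuille flow. -/
def spiralU (R1 R2 α β : ℝ) (x : E3) : E3 :=
  (α * couetteU R1 R2 (rho x)) • eTheta x + (β * poiseuilleU R1 R2 (rho x)) • eZ

/-- Pressure of the spiral Poiseuille flow. -/
def spiralP (R1 R2 α β : ℝ) (x : E3) : ℝ := α ^ 2 * couetteP R1 R2 (rho x) + β * x 2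

/-- The constant measuring the magnitude of the flow. -/
def Mflow (R1 R2 α β : ℝ) : ℝ :=
  Real.sqrt (α ^ 2 * (R2 ^ 2 / (R2 ^ 2 - R1 ^ 2) ^ 2) +
    β ^ 2 / 16 * ((R2 ^ 2 - R1 ^ 2) / (R1 * Real.log (R2 ^ 2 / R1 ^ 2)) - R1) ^ 2)

/-! ### The boundary value problem -/

/-- `u = 0` on the inner cylinder and `u = α e_θ` on the outer one, in the sense of traces:
locally up to the boundary, `u` differs by a field with components in `H¹₀` from a smooth field
that takes these boundary values. -/
def HasBoundaryValues (R1 R2 α : ℝ) (u : E3 → E3) : Prop :=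
  ∃ w : E3 → E3, ContDiff ℝ ∞ w ∧
    (∀ x ∈ cylinder R1, w x = 0) ∧
    (∀ x ∈ cylinder R2, w x = α • eTheta x) ∧
    ∀ χ : E3 → ℝ, IsTest Set.univ χ →
      ∀ i, ∃ g, IsH10 (annulus R1 R2) (fun x => χ x * (u x i - w x i)) g

/-- `(u, p)` is a weak solution of the stationary Navier-Stokes equations
`-Δu + (u·∇)u + ∇p = 0`, `∇·u = 0` in the annulus, with `u = 0` on the inner cylinder and
`u = α e_θ` on the outer one. Here `G i j = ∂_j u_i`. -/
def IsSolution (R1 R2 α : ℝ) (u : E3 → E3) (p : E3 → ℝ) : Prop :=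
  (∃ G : Fin 3 → Fin 3 → E3 → ℝ,
    (∀ i, MemL2Loc (annulus R1 R2) (fun x => u x i)) ∧
    (∀ i j, MemL2Loc (annulus R1 R2) (G i j)) ∧
    LocallyIntegrableOn p (annulus R1 R2) ∧
    (∀ i j, IsWeakPartial (annulus R1 R2) j (fun x => u x i) (G i j)) ∧
    (∀ᵐ x ∂(volume.restrict (annulus R1 R2)), ∑ i, G i i x = 0) ∧
    ∀ φ : Fin 3 → E3 → ℝ, (∀ i, IsTest (annulus R1 R2) (φ i)) →
      ∫ x in annulus R1 R2,
        ((∑ i, ∑ j, G i j x * pderiv j (φ i) x) +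
          (∑ i, (∑ j, u x j * G i j x) * φ i x) -
          p x * ∑ i, pderiv i (φ i) x) = 0) ∧
  HasBoundaryValues R1 R2 α u

end CouettePoiseuille

end

/-!
The perturbation `v` is tested against itself. Writing `U` for the velocity of the spiral flow,
which is an exact solution (`integral_spiral_eq_zero`), the weak form satisfied by `(v, q)` is
`perturbation_weak_form`, with convective terms `(U + v) · ∇v` and `v · ∇U`. The first one is
skew-symmetric because `U + v` is solenoidal, and the pressure term disappears because `v` is
solenoidal, so that `‖∇v‖² = -∫ (v · ∇U) · v` (`energy_identity`). The domain is unbounded and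
`v` is merely in `H¹₀`, so the identity is first written for the test functions that approximate
`v`; the cubic term passes to the limit thanks to the Sobolev embedding `H¹₀ ⊆ L⁶`
(`tendsto_L6_of_tendsto_H1`), derived from the Gagliardo-Nirenberg-Sobolev inequality.

The integrand `(v · ∇U) · v` only sees the symmetric part of `∇U`. For the spiral flow it couples
the radial direction with the azimuthal one, with coefficient `α c R1² / ρ²` where
`c = R2 / (R2² - R1²)`, and with the axial one, with coefficient `β / 4 * (ρ - K / (2 ρ))` where
`K = (R2² - R1²) / log (R2 / R1)`. Both coefficients are largest in absolute value on the inner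
cylinder, where their Euclidean norm is `M` (`abs_strain_le`). Hence
`Λ ‖v‖² ≤ ‖∇v‖² ≤ M ‖v‖²`, and `M < Λ` forces `v = 0`.

With `v = 0`, the vertical derivative of `q` vanishes, so the integral of `q` against a test
function is invariant under vertical translations of the latter. Since `q` is square integrable
its mass at vertical infinity is small, and these integrals vanish
(`ae_eq_zero_of_vertical_derivative`).
-/

noncomputable section

namespace CouettePoiseuille

/-! ### Test functions and weak derivatives -/

section TestFunctions

variable {Ω : Set E3} {φ ψ f g h : E3 → ℝ} {j : Fin 3}

theorem IsTest.mono {Ω' : Set E3} (hφ : IsTest Ω φ) (h : Ω ⊆ Ω') : IsTest Ω' φ :=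
  ⟨hφ.smooth, hφ.compact, hφ.support.trans h⟩

theorem IsTest.differentiable (hφ : IsTest Ω φ) : Differentiable ℝ φ :=
  hφ.smooth.differentiable (by simp)

theorem IsTest.sub (hφ : IsTest Ω φ) (hψ : IsTest Ω ψ) : IsTest Ω (fun x => φ x - ψ x) :=
  ⟨hφ.smooth.sub hψ.smooth, hφ.compact.sub hψ.compact,
    (tsupport_sub φ ψ).trans (Set.union_subset hφ.support hψ.support)⟩

theorem IsTest.half_sq (hφ : IsTest Ω φ) : IsTest Ω (fun x => φ x ^ 2 / 2) := by
  have e : (fun x => φ x ^ 2 / 2) = (fun x => φ x / 2 * φ x) := by ext; ring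
  rw [e]
  exact ⟨(hφ.smooth.div_const _).mul hφ.smooth, hφ.compact.mul_left,
    (tsupport_mul_subset_right).trans hφ.support⟩

theorem isTest_zero : IsTest Ω (fun _ => (0 : ℝ)) :=
  ⟨contDiff_const, HasCompactSupport.zero, by
    have : tsupport (fun _ : E3 => (0 : ℝ)) = ∅ := tsupport_eq_empty_iff.2 rfl
    simp [this]⟩

theorem IsTest.pderiv (hφ : IsTest Ω φ) (j : Fin 3) : IsTest Ω (pderiv j φ) :=
  ⟨(hφ.smooth.fderiv_right (m := ∞) (by simp)).clm_apply contDiff_const,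
    hφ.compact.fderiv_apply (𝕜 := ℝ) _,
    (tsupport_fderiv_apply_subset ℝ _).trans hφ.support⟩

theorem IsTest.memLp (hφ : IsTest Ω φ) (p : ENNReal) (μ : Measure E3)
    [IsFiniteMeasureOnCompacts μ] : MemLp φ p μ :=
  hφ.smooth.continuous.memLp_of_hasCompactSupport hφ.compact

theorem pderiv_sub_apply (hφ : Differentiable ℝ φ) (hψ : Differentiable ℝ ψ) (x : E3) :
    pderiv j (fun x => φ x - ψ x) x = pderiv j φ x - pderiv j ψ x := by
  simp only [CouettePoiseuille.pderiv]
  rw [fderiv_fun_sub (hφ x) (hψ x)]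
  rfl

theorem pderiv_half_sq (hφ : Differentiable ℝ φ) (x : E3) :
    pderiv j (fun x => φ x ^ 2 / 2) x = φ x * pderiv j φ x := by
  have := (((hφ x).hasFDerivAt.pow 2).mul_const (1 / 2 : ℝ)).fderiv
  have e : (fun x => φ x ^ 2 / 2) = (fun x => φ x ^ 2 * (1 / 2 : ℝ)) := by ext; ring
  simp only [CouettePoiseuille.pderiv]
  rw [e, this]
  simp
  ring

theorem pderiv_zero (x : E3) : pderiv j (fun _ => (0 : ℝ)) x = 0 := by
  simp [CouettePoiseuille.pderiv]

theorem IsTest.eq_zero (hφ : IsTest Ω φ) {x : E3} (hx : x ∉ Ω) : φ x = 0 :=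
  image_eq_zero_of_notMem_tsupport fun h => hx (hφ.support h)

theorem IsTest.setIntegral_mul (hφ : IsTest Ω φ) (f : E3 → ℝ) :
    ∫ x in Ω, f x * φ x = ∫ x, f x * φ x :=
  setIntegral_eq_integral_of_forall_compl_eq_zero fun x hx => by simp [hφ.eq_zero hx]

theorem IsTest.eLpNorm_restrict (hφ : IsTest Ω φ) (p : ENNReal) :
    eLpNorm φ p (volume.restrict Ω) = eLpNorm φ p volume :=
  eLpNorm_restrict_eq_of_support_subset ((subset_tsupport φ).trans hφ.support)

theorem IsTest.integrable_continuousOn_mul (hΩ : IsOpen Ω) (hf : ContinuousOn f Ω)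
    (hφ : IsTest Ω φ) : Integrable (fun x => f x * φ x) := by
  refine Continuous.integrable_of_hasCompactSupport (continuous_of_tsupport fun x hx => ?_)
    (hφ.compact.mul_left)
  have hx' : x ∈ Ω := hφ.support (tsupport_mul_subset_right hx)
  exact ((hf x hx').continuousAt (hΩ.mem_nhds hx')).mul hφ.smooth.continuous.continuousAt

/-- Integration by parts on an open set, against a test function: no regularity of the set is
needed, and the other factor only has to be differentiable inside. -/
theorem IsTest.integral_mul_pderiv (hΩ : IsOpen Ω) (hf : ∀ x ∈ Ω, DifferentiableAt ℝ f x)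
    (hfg : ∀ x ∈ Ω, CouettePoiseuille.pderiv j f x = g x) (hg : ContinuousOn g Ω)
    (hφ : IsTest Ω φ) :
    ∫ x in Ω, f x * CouettePoiseuille.pderiv j φ x = -∫ x in Ω, g x * φ x := by
  have hfc : ContinuousOn f Ω := fun x hx => (hf x hx).continuousAt.continuousWithinAt
  have e : (fun x => CouettePoiseuille.pderiv j f x * φ x) = fun x => g x * φ x := by
    ext x
    by_cases hx : x ∈ Ω
    · rw [hfg x hx]
    · simp [hφ.eq_zero hx]
  rw [(hφ.pderiv j).setIntegral_mul, hφ.setIntegral_mul, ← e]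
  refine integral_mul_fderiv_eq_neg_fderiv_mul_of_integrable ?_
    ((hφ.pderiv j).integrable_continuousOn_mul hΩ hfc)
    (hφ.integrable_continuousOn_mul hΩ hfc) (fun x hx => hf x (hφ.support hx))
    fun x _ => hφ.differentiable x
  exact e ▸ hφ.integrable_continuousOn_mul hΩ hg

/-- A locally integrable function which is orthogonal to all test functions vanishes. -/
theorem ae_eq_zero_of_forall_test (hΩ : IsOpen Ω) (hf : LocallyIntegrableOn f Ω)
    (h : ∀ φ, IsTest Ω φ → ∫ x in Ω, f x * φ x = 0) : f =ᵐ[volume.restrict Ω] 0 := by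
  refine (ae_restrict_iff' hΩ.measurableSet).2 ?_
  refine hΩ.ae_eq_zero_of_integral_contDiff_smul_eq_zero hf fun φ h1 h2 h3 => ?_
  have hφ : IsTest Ω φ := ⟨h1, h2, h3⟩
  rw [← h φ hφ, hφ.setIntegral_mul]
  simp [mul_comm]

theorem integrable_mul_test_of_locallyIntegrableOn (hf : LocallyIntegrableOn f Ω)
    (hφ : IsTest Ω φ) : Integrable (fun x => f x * φ x) (volume.restrict Ω) := by
  have hK : IntegrableOn f (tsupport φ) :=
    hf.integrableOn_compact_subset hφ.support hφ.compact
  have h2 : IntegrableOn (fun x => f x * φ x) (tsupport φ) :=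
    hK.mul_continuousOn hφ.smooth.continuous.continuousOn hφ.compact
  refine Integrable.integrableOn ((integrableOn_iff_integrable_of_support_subset ?_).1 h2)
  exact (Function.support_mul_subset_right _ _).trans (subset_tsupport φ)

theorem IsWeakPartial.unique (hΩ : IsOpen Ω) (hg : IsWeakPartial Ω j f g)
    (hh : IsWeakPartial Ω j f h) : g =ᵐ[volume.restrict Ω] h := by
  have : (g - h) =ᵐ[volume.restrict Ω] 0 := by
    refine ae_eq_zero_of_forall_test hΩ (hg.locInt_deriv.sub hh.locInt_deriv) fun φ hφ => ?_
    have h1 := hg.byParts φ hφ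
    rw [hh.byParts φ hφ] at h1
    simp only [Pi.sub_apply, sub_mul]
    rw [integral_sub (integrable_mul_test_of_locallyIntegrableOn hg.locInt_deriv hφ)
      (integrable_mul_test_of_locallyIntegrableOn hh.locInt_deriv hφ)]
    linarith
  filter_upwards [this] with x hx
  simpa [sub_eq_zero] using hx

theorem IsWeakPartial.add {f' g' : E3 → ℝ} (hf : IsWeakPartial Ω j f g)
    (hf' : IsWeakPartial Ω j f' g') :
    IsWeakPartial Ω j (fun x => f x + f' x) (fun x => g x + g' x) := by
  refine ⟨hf.locInt.add hf'.locInt, hf.locInt_deriv.add hf'.locInt_deriv, fun φ hφ => ?_⟩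
  simp only [add_mul]
  have i := @integrable_mul_test_of_locallyIntegrableOn Ω
  rw [integral_add (i hf.locInt (hφ.pderiv j)) (i hf'.locInt (hφ.pderiv j)),
    integral_add (i hf.locInt_deriv hφ) (i hf'.locInt_deriv hφ), hf.byParts φ hφ,
    hf'.byParts φ hφ]
  ring

end TestFunctions

/-! ### Limits of products and the Sobolev embedding -/

section Limits

variable {Ω : Set E3}

theorem tendsto_integral_mul_of_L2 {μ : Measure E3} {F G : ℕ → E3 → ℝ} {f g : E3 → ℝ}
    (hF : ∀ n, MemLp (F n) 2 μ) (hG : ∀ n, MemLp (G n) 2 μ) (hf : MemLp f 2 μ)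
    (hg : MemLp g 2 μ) (hFf : Tendsto (fun n => eLpNorm (F n - f) 2 μ) atTop (𝓝 0))
    (hGg : Tendsto (fun n => eLpNorm (G n - g) 2 μ) atTop (𝓝 0)) :
    Tendsto (fun n => ∫ x, F n x * G n x ∂μ) atTop (𝓝 (∫ x, f x * g x ∂μ)) := by
  have h1 := (Lp.tendsto_Lp_iff_tendsto_eLpNorm'' F hF f hf).2 hFf
  have h2 := (Lp.tendsto_Lp_iff_tendsto_eLpNorm'' G hG g hg).2 hGg
  have key : ∀ {a b : E3 → ℝ} (ha : MemLp a 2 μ) (hb : MemLp b 2 μ),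
      inner ℝ (ha.toLp a) (hb.toLp b) = ∫ x, a x * b x ∂μ := by
    intro a b ha hb
    rw [L2.inner_def]
    refine integral_congr_ae ?_
    filter_upwards [ha.coeFn_toLp, hb.coeFn_toLp] with x hx hy
    rw [hx, hy]
    simp [mul_comm]
  have := h1.inner (𝕜 := ℝ) h2
  simpa only [key] using this

theorem tendsto_eLpNorm_mul_sub {μ : Measure E3} {p q r : ENNReal} [p.HolderTriple q r]
    {a f : E3 → ℝ} {F : ℕ → E3 → ℝ} (ha : MemLp a p μ) (hF : ∀ n, MemLp (F n) q μ)
    (hf : MemLp f q μ) (h : Tendsto (fun n => eLpNorm (F n - f) q μ) atTop (𝓝 0)) :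
    Tendsto (fun n => eLpNorm (a * F n - a * f) r μ) atTop (𝓝 0) := by
  have h0 : Tendsto (fun n => eLpNorm a p μ * eLpNorm (F n - f) q μ) atTop (𝓝 0) := by
    simpa using ENNReal.Tendsto.const_mul h (Or.inr ha.2.ne)
  refine tendsto_of_tendsto_of_tendsto_of_le_of_le tendsto_const_nhds h0 (fun _ => bot_le) ?_
  intro n
  have := eLpNorm_smul_le_mul_eLpNorm (p := p) (q := q) (r := r) ((hF n).sub hf).1 ha.1
  simpa [mul_sub] using this

theorem memLp_three_of_two_six {μ : Measure E3} {f : E3 → ℝ} (h2 : MemLp f 2 μ)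
    (h6 : MemLp f 6 μ) : MemLp f 3 μ := by
  have i2 := h2.integrable_norm_pow (p := 2) (by norm_num)
  have i6 := h6.integrable_norm_pow (p := 6) (by norm_num)
  have := (integrable_norm_rpow_iff h2.1 (p := 3) (by norm_num) (by norm_num)).1 ?_
  · exact this
  refine (i2.add i6).mono' (h2.1.norm.aemeasurable.pow_const _).aestronglyMeasurable ?_
  refine Eventually.of_forall fun x => ?_
  have e : (3 : ENNReal).toReal = ((3 : ℕ) : ℝ) := by norm_num
  rw [e, Real.rpow_natCast]
  have h0 := norm_nonneg (f x)
  rw [Real.norm_of_nonneg (by positivity)]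
  simp only [Pi.add_apply]
  set t := ‖f x‖
  nlinarith [sq_nonneg (t ^ 2 * t - t), sq_nonneg (t ^ 3 - 1), pow_nonneg h0 3,
    mul_nonneg (sq_nonneg t) (sq_nonneg (t ^ 2 - 1)), mul_nonneg (sq_nonneg t) (sq_nonneg (t - 1))]

theorem exists_sobolev_const : ∃ C : NNReal, ∀ φ : E3 → ℝ, IsTest Set.univ φ →
    eLpNorm φ 6 volume ≤ C * ∑ j, eLpNorm (pderiv j φ) 2 volume := by
  refine ⟨eLpNormLESNormFDerivOfEqInnerConst (volume : Measure E3) (2 : NNReal), fun φ hφ => ?_⟩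
  have h := eLpNorm_le_eLpNorm_fderiv_of_eq_inner (volume : Measure E3) (u := φ)
    (hφ.smooth.of_le (by simp)) hφ.compact (p := 2) (p' := 6) (by norm_num) (by simp)
    (by simp; norm_num)
  refine h.trans (mul_le_mul' le_rfl ?_)
  rw [ENNReal.coe_ofNat]
  refine le_trans ?_ (eLpNorm_sum_le (p := 2) (fun j _ => ((hφ.pderiv j).memLp 2 volume).norm.1)
    (by norm_num)) |>.trans (le_of_eq (Finset.sum_congr rfl fun j _ => eLpNorm_norm _))
  refine eLpNorm_mono_real fun x => ?_
  refine ContinuousLinearMap.opNorm_le_bound _ (by simp; positivity) fun y => ?_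
  have hy : y = ∑ j, y j • EuclideanSpace.single j (1 : ℝ) := by
    ext i; simp [Finset.sum_apply, Pi.single_apply]
  conv_lhs => rw [hy]
  rw [map_sum]
  simp only [Finset.sum_apply, Finset.sum_mul]
  refine (norm_sum_le _ _).trans (Finset.sum_le_sum fun j _ => ?_)
  rw [map_smul, norm_smul, mul_comm]
  exact mul_le_mul_of_nonneg_left (PiLp.norm_apply_le y j) (norm_nonneg _)

/-- The Sobolev embedding `H¹₀ ⊆ L⁶`, with convergence in `L⁶` of the approximating test
functions. It follows from the inequality for test functions, applied to the differences of the
sequence, by Fatou's lemma along an almost everywhere convergent subsequence. -/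
theorem tendsto_L6_of_tendsto_H1 {f : E3 → ℝ} {g : Fin 3 → E3 → ℝ}
    {φ : ℕ → E3 → ℝ} (hf : MemL2 Ω f) (hg : ∀ j, MemL2 Ω (g j)) (hφ : ∀ n, IsTest Ω (φ n))
    (h0 : Tendsto (fun n => eLpNorm (fun x => φ n x - f x) 2 (volume.restrict Ω)) atTop (𝓝 0))
    (h1 : ∀ j, Tendsto (fun n => eLpNorm (fun x => pderiv j (φ n) x - g j x) 2
      (volume.restrict Ω)) atTop (𝓝 0)) :
    MemLp f 6 (volume.restrict Ω) ∧
      Tendsto (fun n => eLpNorm (φ n - f) 6 (volume.restrict Ω)) atTop (𝓝 0) := by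
  obtain ⟨C, hC⟩ := exists_sobolev_const
  set μ := volume.restrict Ω with hμ
  set a : ℕ → ENNReal := fun n => ∑ j, eLpNorm (fun x => pderiv j (φ n) x - g j x) 2 μ with ha
  have a0 : Tendsto a atTop (𝓝 0) := by
    have := tendsto_finsetSum (Finset.univ : Finset (Fin 3)) fun j _ => h1 j
    simpa using this
  have hd : ∀ n m, eLpNorm (φ n - φ m) 6 μ ≤ C * (a n + a m) := by
    intro n m
    have ht := (hφ n).sub (hφ m)
    have := hC _ (ht.mono (Set.subset_univ _))
    rw [← ht.eLpNorm_restrict] at this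
    refine this.trans ?_
    gcongr
    rw [ha, ← Finset.sum_add_distrib]
    refine Finset.sum_le_sum fun j _ => ?_
    rw [← (ht.pderiv j).eLpNorm_restrict]
    have e : pderiv j (fun x => φ n x - φ m x) =
        (fun x => pderiv j (φ n) x - g j x) - (fun x => pderiv j (φ m) x - g j x) := by
      ext x
      rw [pderiv_sub_apply (hφ n).differentiable (hφ m).differentiable]
      simp
    rw [e]
    exact eLpNorm_sub_le ((((hφ n).pderiv j).memLp 2 μ).sub (hg j)).1
      ((((hφ m).pderiv j).memLp 2 μ).sub (hg j)).1 (by norm_num)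
  obtain ⟨ns, hns, hae⟩ := (tendstoInMeasure_of_tendsto_eLpNorm (p := 2) (by norm_num)
    (fun n => ((hφ n).memLp 2 μ).1) hf.1 h0).exists_seq_tendsto_ae
  have hb : ∀ n, eLpNorm (φ n - f) 6 μ ≤ C * a n := by
    intro n
    have l1 := Lp.eLpNorm_lim_le_liminf_eLpNorm (p := 6) (μ := μ)
      (f := fun k => φ n - φ (ns k)) (fun k => (((hφ n).memLp 2 μ).sub ((hφ _).memLp 2 μ)).1)
      (φ n - f) (by
        filter_upwards [hae] with x hx
        exact tendsto_const_nhds.sub hx)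
    have l2 : Tendsto (fun k => C * (a n + a (ns k))) atTop (𝓝 (C * (a n + 0))) :=
      ENNReal.Tendsto.const_mul (tendsto_const_nhds.add (a0.comp hns.tendsto_atTop))
        (Or.inr ENNReal.coe_ne_top)
    refine l1.trans ?_
    calc _ ≤ liminf (fun k => C * (a n + a (ns k))) atTop :=
          liminf_le_liminf (Eventually.of_forall fun k => hd n (ns k))
      _ = C * a n := by rw [l2.liminf_eq, add_zero]
  have hlim : Tendsto (fun n => eLpNorm (φ n - f) 6 μ) atTop (𝓝 0) := by
    refine tendsto_of_tendsto_of_tendsto_of_le_of_le tendsto_const_nhds ?_ (fun _ => bot_le) hb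
    simpa using ENNReal.Tendsto.const_mul a0 (Or.inr (ENNReal.coe_ne_top (r := C)))
  refine ⟨?_, hlim⟩
  obtain ⟨n, hn⟩ := (hlim.eventually_lt_const (zero_lt_one)).exists
  have hm : MemLp (φ n - f) 6 μ :=
    ⟨(((hφ n).memLp 2 μ).sub hf).1, hn.trans ENNReal.one_lt_top⟩
  simpa using ((hφ n).memLp 6 μ).sub hm

end Limits

/-! ### Calculus of partial derivatives on an open set -/

/-- On `Ω`, the function `f` is differentiable and its classical `j`-th partial derivative is the
continuous function `g`. -/
structure HasPartialOn (Ω : Set E3) (j : Fin 3) (f g : E3 → ℝ) : Prop where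
  diff : ∀ x ∈ Ω, DifferentiableAt ℝ f x
  eq : ∀ x ∈ Ω, pderiv j f x = g x
  cont : ContinuousOn g Ω

section Rules

variable {Ω : Set E3} {f g f' g' : E3 → ℝ} {j : Fin 3}

theorem HasPartialOn.continuousOn (h : HasPartialOn Ω j f g) : ContinuousOn f Ω :=
  fun x hx => (h.diff x hx).continuousAt.continuousWithinAt

theorem HasPartialOn.congr (h : HasPartialOn Ω j f g) (hg : ∀ x ∈ Ω, g x = g' x) :
    HasPartialOn Ω j f g' :=
  ⟨h.diff, fun x hx => (h.eq x hx).trans (hg x hx), h.cont.congr fun x hx => (hg x hx).symm⟩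

theorem HasPartialOn.congr_left (hΩ : IsOpen Ω) (h : HasPartialOn Ω j f g)
    (hf : ∀ x ∈ Ω, f' x = f x) : HasPartialOn Ω j f' g := by
  have e : ∀ x ∈ Ω, f' =ᶠ[𝓝 x] f := fun x hx =>
    Filter.eventually_of_mem (hΩ.mem_nhds hx) hf
  refine ⟨fun x hx => (h.diff x hx).congr_of_eventuallyEq (e x hx), fun x hx => ?_, h.cont⟩
  rw [← h.eq x hx, pderiv, pderiv, (e x hx).fderiv_eq]

theorem HasPartialOn.const (c : ℝ) : HasPartialOn Ω j (fun _ => c) (fun _ => 0) :=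
  ⟨fun _ _ => differentiableAt_const c, fun x _ => by simp [pderiv], continuousOn_const⟩

theorem HasPartialOn.coord (k : Fin 3) :
    HasPartialOn Ω j (fun x => x k) (fun _ => if k = j then 1 else 0) := by
  have h : ∀ x : E3, HasFDerivAt (fun x : E3 => x k)
      (EuclideanSpace.proj k : E3 →L[ℝ] ℝ) x := fun x =>
    (EuclideanSpace.proj k : E3 →L[ℝ] ℝ).hasFDerivAt
  refine ⟨fun x _ => (h x).differentiableAt, fun x _ => ?_, continuousOn_const⟩
  rw [pderiv, (h x).fderiv]
  simp

theorem HasPartialOn.add (h : HasPartialOn Ω j f g) (h' : HasPartialOn Ω j f' g') :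
    HasPartialOn Ω j (fun x => f x + f' x) (fun x => g x + g' x) := by
  refine ⟨fun x hx => (h.diff x hx).add (h'.diff x hx), fun x hx => ?_, h.cont.add h'.cont⟩
  rw [← h.eq x hx, ← h'.eq x hx, pderiv, fderiv_fun_add (h.diff x hx) (h'.diff x hx)]
  rfl

theorem HasPartialOn.mul (h : HasPartialOn Ω j f g) (h' : HasPartialOn Ω j f' g') :
    HasPartialOn Ω j (fun x => f x * f' x) (fun x => f x * g' x + f' x * g x) := by
  refine ⟨fun x hx => (h.diff x hx).mul (h'.diff x hx), fun x hx => ?_,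
    (h.continuousOn.mul h'.cont).add (h'.continuousOn.mul h.cont)⟩
  rw [← h.eq x hx, ← h'.eq x hx, pderiv, fderiv_fun_mul (h.diff x hx) (h'.diff x hx)]
  rfl

theorem HasPartialOn.neg (h : HasPartialOn Ω j f g) :
    HasPartialOn Ω j (fun x => -f x) (fun x => -g x) := by
  simpa using (HasPartialOn.const (-1)).mul h

theorem HasPartialOn.sub (h : HasPartialOn Ω j f g) (h' : HasPartialOn Ω j f' g') :
    HasPartialOn Ω j (fun x => f x - f' x) (fun x => g x - g' x) := by
  simpa [sub_eq_add_neg] using h.add h'.neg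

theorem HasPartialOn.inv (h : HasPartialOn Ω j f g) (h0 : ∀ x ∈ Ω, f x ≠ 0) :
    HasPartialOn Ω j (fun x => (f x)⁻¹) (fun x => -g x * (f x)⁻¹ ^ 2) := by
  have hd : ∀ x ∈ Ω, HasFDerivAt (fun x => (f x)⁻¹) (-(f x ^ 2)⁻¹ • fderiv ℝ f x) x :=
    fun x hx => (hasDerivAt_inv (h0 x hx)).comp_hasFDerivAt x (h.diff x hx).hasFDerivAt
  refine ⟨fun x hx => (hd x hx).differentiableAt, fun x hx => ?_,
    h.cont.neg.mul ((h.continuousOn.inv₀ h0).pow 2)⟩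
  rw [← h.eq x hx, pderiv, (hd x hx).fderiv, pderiv]
  simp
  ring

theorem HasPartialOn.log (h : HasPartialOn Ω j f g) (h0 : ∀ x ∈ Ω, f x ≠ 0) :
    HasPartialOn Ω j (fun x => Real.log (f x)) (fun x => g x * (f x)⁻¹) := by
  have hd : ∀ x ∈ Ω, HasFDerivAt (fun x => Real.log (f x)) ((f x)⁻¹ • fderiv ℝ f x) x :=
    fun x hx => (h.diff x hx).hasFDerivAt.log (h0 x hx)
  refine ⟨fun x hx => (hd x hx).differentiableAt, fun x hx => ?_,
    h.cont.mul (h.continuousOn.inv₀ h0)⟩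
  rw [← h.eq x hx, pderiv, (hd x hx).fderiv, pderiv]
  simp
  ring

theorem HasPartialOn.integral_mul_pderiv (hΩ : IsOpen Ω) (h : HasPartialOn Ω j f g)
    {φ : E3 → ℝ} (hφ : IsTest Ω φ) :
    ∫ x in Ω, f x * pderiv j φ x = -∫ x in Ω, g x * φ x :=
  hφ.integral_mul_pderiv hΩ h.diff h.eq h.cont

theorem HasPartialOn.isWeakPartial (hΩ : IsOpen Ω) (h : HasPartialOn Ω j f g) :
    IsWeakPartial Ω j f g :=
  ⟨h.continuousOn.locallyIntegrableOn hΩ.measurableSet,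
    h.cont.locallyIntegrableOn hΩ.measurableSet, fun _ hφ => h.integral_mul_pderiv hΩ hφ⟩

end Rules

/-! ### The annulus -/

section Annulus

variable {R1 R2 : ℝ}

/-- The square of the distance to the axis. -/
def rhoSq (x : E3) : ℝ := x 0 ^ 2 + x 1 ^ 2

theorem rho_sq (x : E3) : rho x ^ 2 = rhoSq x := Real.sq_sqrt (by positivity)

theorem continuous_rho : Continuous rho := by
  unfold rho; fun_prop

theorem isOpen_annulus : IsOpen (annulus R1 R2) :=
  (isOpen_lt continuous_const continuous_rho).inter (isOpen_lt continuous_rho continuous_const)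

theorem sq_lt_rhoSq (hR1 : 0 < R1) {x : E3} (hx : x ∈ annulus R1 R2) : R1 ^ 2 < rhoSq x := by
  rw [← rho_sq]
  exact pow_lt_pow_left₀ hx.1 hR1.le (by norm_num)

theorem rhoSq_lt_sq (hR1 : 0 < R1) {x : E3} (hx : x ∈ annulus R1 R2) : rhoSq x < R2 ^ 2 := by
  rw [← rho_sq]
  exact pow_lt_pow_left₀ hx.2 (hR1.le.trans hx.1.le) (by norm_num)

theorem rhoSq_pos (hR1 : 0 < R1) {x : E3} (hx : x ∈ annulus R1 R2) : 0 < rhoSq x :=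
  (pow_pos hR1 2).trans (sq_lt_rhoSq hR1 hx)

theorem hasPartialOn_rhoSq {Ω : Set E3} (j : Fin 3) :
    HasPartialOn Ω j rhoSq (fun x => if j = 2 then 0 else 2 * x j) := by
  have h0 := HasPartialOn.coord (Ω := Ω) (j := j) 0
  have h1 := HasPartialOn.coord (Ω := Ω) (j := j) 1
  have h := ((h0.mul h0).add (h1.mul h1)).congr (g' := fun x => if j = 2 then 0 else 2 * x j)
    (by intro x _; fin_cases j <;> simp <;> ring)
  have e : rhoSq = fun x => x 0 * x 0 + x 1 * x 1 := by ext x; simp [rhoSq]; ring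
  rw [e]
  exact h

theorem hasPartialOn_inv_rhoSq (hR1 : 0 < R1) (j : Fin 3) :
    HasPartialOn (annulus R1 R2) j (fun x => (rhoSq x)⁻¹)
      (fun x => -(if j = 2 then 0 else 2 * x j) * (rhoSq x)⁻¹ ^ 2) :=
  (hasPartialOn_rhoSq j).inv fun _ hx => (rhoSq_pos hR1 hx).ne'

theorem hasPartialOn_log_rhoSq (hR1 : 0 < R1) (j : Fin 3) :
    HasPartialOn (annulus R1 R2) j (fun x => Real.log (rhoSq x))
      (fun x => (if j = 2 then 0 else 2 * x j) * (rhoSq x)⁻¹) :=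
  (hasPartialOn_rhoSq j).log fun _ hx => (rhoSq_pos hR1 hx).ne'

/-- `f` is bounded on `Ω`. -/
def BddOn (Ω : Set E3) (f : E3 → ℝ) : Prop := ∃ C, ∀ x ∈ Ω, |f x| ≤ C

variable {Ω : Set E3} {f g : E3 → ℝ}

theorem BddOn.const (c : ℝ) : BddOn Ω (fun _ => c) := ⟨|c|, fun _ _ => le_rfl⟩

theorem BddOn.add (hf : BddOn Ω f) (hg : BddOn Ω g) : BddOn Ω (fun x => f x + g x) := by
  obtain ⟨C, hC⟩ := hf
  obtain ⟨D, hD⟩ := hg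
  exact ⟨C + D, fun x hx => (abs_add_le _ _).trans (add_le_add (hC x hx) (hD x hx))⟩

theorem BddOn.mul (hf : BddOn Ω f) (hg : BddOn Ω g) : BddOn Ω (fun x => f x * g x) := by
  obtain ⟨C, hC⟩ := hf
  obtain ⟨D, hD⟩ := hg
  refine ⟨C * D, fun x hx => ?_⟩
  rw [abs_mul]
  exact mul_le_mul (hC x hx) (hD x hx) (abs_nonneg _) ((abs_nonneg _).trans (hC x hx))

theorem BddOn.neg (hf : BddOn Ω f) : BddOn Ω (fun x => -f x) := by
  simpa using (BddOn.const (-1)).mul hf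

theorem BddOn.sub (hf : BddOn Ω f) (hg : BddOn Ω g) : BddOn Ω (fun x => f x - g x) := by
  simpa [sub_eq_add_neg] using hf.add hg.neg

theorem BddOn.memLp_top (hΩ : IsOpen Ω) (hf : BddOn Ω f) (hc : ContinuousOn f Ω) :
    MemLp f ⊤ (volume.restrict Ω) := by
  obtain ⟨C, hC⟩ := hf
  exact memLp_top_of_bound (hc.aestronglyMeasurable hΩ.measurableSet) C
    ((ae_restrict_iff' hΩ.measurableSet).2 (Eventually.of_forall hC))

theorem bddOn_coord_zero (hR1 : 0 < R1) : BddOn (annulus R1 R2) (fun x => x 0) :=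
  ⟨R2, fun x hx => abs_le_of_sq_le_sq (by
    have := rhoSq_lt_sq hR1 hx
    unfold rhoSq at this
    nlinarith [sq_nonneg (x 1)]) (hR1.le.trans (hx.1.trans hx.2).le)⟩

theorem bddOn_coord_one (hR1 : 0 < R1) : BddOn (annulus R1 R2) (fun x => x 1) :=
  ⟨R2, fun x hx => abs_le_of_sq_le_sq (by
    have := rhoSq_lt_sq hR1 hx
    unfold rhoSq at this
    nlinarith [sq_nonneg (x 0)]) (hR1.le.trans (hx.1.trans hx.2).le)⟩

theorem bddOn_rhoSq (hR1 : 0 < R1) : BddOn (annulus R1 R2) rhoSq :=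
  ⟨R2 ^ 2, fun _ hx => by rw [abs_of_pos (rhoSq_pos hR1 hx)]; exact (rhoSq_lt_sq hR1 hx).le⟩

theorem bddOn_inv_rhoSq (hR1 : 0 < R1) : BddOn (annulus R1 R2) (fun x => (rhoSq x)⁻¹) :=
  ⟨(R1 ^ 2)⁻¹, fun _ hx => by
    rw [abs_of_pos (inv_pos.2 (rhoSq_pos hR1 hx))]
    exact inv_anti₀ (pow_pos hR1 2) (sq_lt_rhoSq hR1 hx).le⟩

theorem bddOn_log_rhoSq (hR1 : 0 < R1) :
    BddOn (annulus R1 R2) (fun x => Real.log (rhoSq x)) := by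
  refine ⟨max |Real.log (R1 ^ 2)| |Real.log (R2 ^ 2)|, fun x hx => abs_le_max_abs_abs ?_ ?_⟩
  · exact Real.log_le_log (pow_pos hR1 2) (sq_lt_rhoSq hR1 hx).le
  · exact Real.log_le_log (rhoSq_pos hR1 hx) (rhoSq_lt_sq hR1 hx).le

end Annulus

/-! ### The spiral flow in Cartesian coordinates -/

section Flow

variable (R1 R2 α β : ℝ)

/-- The coefficient of the azimuthal part of the flow. -/
def swirl : ℝ := α * (R2 / (R2 ^ 2 - R1 ^ 2))

/-- The coefficient of the logarithm in the Poiseuille profile. -/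
def logCoeff : ℝ := (R2 ^ 2 - R1 ^ 2) / Real.log (R2 / R1)

/-- The angular velocity of the flow. -/
def angVel (x : E3) : ℝ := swirl R1 R2 α * (1 - R1 ^ 2 * (rhoSq x)⁻¹)

/-- The Cartesian components of the velocity of the spiral flow. -/
def velocity (i : Fin 3) (x : E3) : ℝ :=
  ![-(x 1 * angVel R1 R2 α x), x 0 * angVel R1 R2 α x,
    β / 4 * (rhoSq x - R1 ^ 2 - logCoeff R1 R2 * (1 / 2 * Real.log (rhoSq x) - Real.log R1))] i

/-- The partial derivatives `∂_j U_i` of the velocity of the spiral flow. -/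
def velocityGrad (i j : Fin 3) (x : E3) : ℝ :=
  ![![-(x 1 * (swirl R1 R2 α * (R1 ^ 2 * (2 * (x 0 * ((rhoSq x)⁻¹ * (rhoSq x)⁻¹)))))),
      -(angVel R1 R2 α x +
        x 1 * (swirl R1 R2 α * (R1 ^ 2 * (2 * (x 1 * ((rhoSq x)⁻¹ * (rhoSq x)⁻¹)))))), 0],
    ![angVel R1 R2 α x +
        x 0 * (swirl R1 R2 α * (R1 ^ 2 * (2 * (x 0 * ((rhoSq x)⁻¹ * (rhoSq x)⁻¹))))),
      x 0 * (swirl R1 R2 α * (R1 ^ 2 * (2 * (x 1 * ((rhoSq x)⁻¹ * (rhoSq x)⁻¹))))), 0],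
    ![β / 4 * (2 * x 0 - logCoeff R1 R2 * (x 0 * (rhoSq x)⁻¹)),
      β / 4 * (2 * x 1 - logCoeff R1 R2 * (x 1 * (rhoSq x)⁻¹)), 0]] i j

/-- The gradient of the pressure of the spiral flow. -/
def pressureGrad (i : Fin 3) (x : E3) : ℝ :=
  ![x 0 * angVel R1 R2 α x ^ 2, x 1 * angVel R1 R2 α x ^ 2, β] i

variable {R1 R2 α β}

theorem log_rho (x : E3) : Real.log (rho x) = 1 / 2 * Real.log (rhoSq x) := by
  rw [rho, Real.log_sqrt (by positivity), rhoSq]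
  ring

theorem spiralU_apply (hR1 : 0 < R1) {x : E3} (hx : x ∈ annulus R1 R2) (i : Fin 3) :
    spiralU R1 R2 α β x i = velocity R1 R2 α β i x := by
  have hρ : 0 < rho x := hR1.trans hx.1
  have hs := rho_sq x
  fin_cases i
  · simp [spiralU, velocity, eTheta, eZ, couetteU, angVel, swirl, ← hs]
    field_simp
  · simp [spiralU, velocity, eTheta, eZ, couetteU, angVel, swirl, ← hs]
    field_simp
  · simp only [spiralU, velocity, eTheta, eZ, poiseuilleU, logCoeff]
    rw [Real.log_div hρ.ne' hR1.ne', log_rho, ← hs]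
    simp
    ring

theorem hasPartialOn_angVel (hR1 : 0 < R1) (j : Fin 3) :
    HasPartialOn (annulus R1 R2) j (angVel R1 R2 α) (fun x => swirl R1 R2 α *
      (R1 ^ 2 * ((if j = 2 then 0 else 2 * x j) * ((rhoSq x)⁻¹ * (rhoSq x)⁻¹)))) := by
  have := (HasPartialOn.const (swirl R1 R2 α)).mul ((HasPartialOn.const (1 : ℝ)).sub
    ((HasPartialOn.const (R1 ^ 2)).mul (hasPartialOn_inv_rhoSq (R2 := R2) hR1 j)))
  exact this.congr fun x _ => by ring

theorem hasPartialOn_velocity (hR1 : 0 < R1) (i j : Fin 3) :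
    HasPartialOn (annulus R1 R2) j (velocity R1 R2 α β i) (velocityGrad R1 R2 α β i j) := by
  have hA := hasPartialOn_angVel (R2 := R2) (α := α) hR1 j
  have h0 := HasPartialOn.coord (Ω := annulus R1 R2) (j := j) 0
  have h1 := HasPartialOn.coord (Ω := annulus R1 R2) (j := j) 1
  have hl := hasPartialOn_log_rhoSq (R2 := R2) hR1 j
  fin_cases i
  · refine (h1.mul hA).neg.congr fun x _ => ?_
    fin_cases j <;> simp [velocityGrad, -mul_eq_mul_left_iff] <;> ring
  · refine (h0.mul hA).congr fun x _ => ?_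
    fin_cases j <;> simp [velocityGrad, -mul_eq_mul_left_iff] <;> ring
  · refine ((HasPartialOn.const (β / 4)).mul (((hasPartialOn_rhoSq j).sub
      (HasPartialOn.const (R1 ^ 2))).sub ((HasPartialOn.const (logCoeff R1 R2)).mul
        (((HasPartialOn.const (1 / 2)).mul hl).sub
          (HasPartialOn.const (Real.log R1)))))).congr fun x _ => ?_
    fin_cases j <;> simp [velocityGrad, -mul_eq_mul_left_iff] <;> ring

theorem hasPartialOn_pressure (hR1 : 0 < R1) (j : Fin 3) :
    HasPartialOn (annulus R1 R2) j (spiralP R1 R2 α β) (pressureGrad R1 R2 α β j) := by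
  have hw := hasPartialOn_inv_rhoSq (R2 := R2) hR1 j
  have hl := hasPartialOn_log_rhoSq (R2 := R2) hR1 j
  have h := ((HasPartialOn.const (1 / 2 * swirl R1 R2 α ^ 2)).mul
    (((hasPartialOn_rhoSq j).sub ((HasPartialOn.const (R1 ^ 4)).mul hw)).sub
      ((HasPartialOn.const (2 * R1 ^ 2)).mul hl))).add
    ((HasPartialOn.const β).mul (HasPartialOn.coord (Ω := annulus R1 R2) (j := j) 2))
  refine (h.congr_left isOpen_annulus fun x hx => ?_).congr fun x hx => ?_
  · rw [spiralP, couetteP, log_rho, rho_sq, swirl]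
    ring
  · have hs := (rhoSq_pos hR1 hx).ne'
    fin_cases j <;> simp [pressureGrad, angVel] <;> field_simp <;> ring

theorem exists_partials_sum_eq {Ω : Set E3} {f : Fin 3 → E3 → ℝ} {g0 g1 g2 S : E3 → ℝ}
    (h0 : HasPartialOn Ω 0 (f 0) g0) (h1 : HasPartialOn Ω 1 (f 1) g1)
    (h2 : HasPartialOn Ω 2 (f 2) g2) (hS : ∀ x ∈ Ω, g0 x + g1 x + g2 x = S x) :
    ∃ D : Fin 3 → E3 → ℝ, (∀ j, HasPartialOn Ω j (f j) (D j)) ∧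
      ∀ x ∈ Ω, ∑ j, D j x = S x := by
  refine ⟨![g0, g1, g2], fun j => ?_, fun x hx => ?_⟩
  · fin_cases j
    exacts [h0, h1, h2]
  · simpa [Fin.sum_univ_three] using hS x hx

/-- The spiral flow solves the momentum equation in the classical sense. -/
theorem exists_velocity_second_derivatives (hR1 : 0 < R1) (i : Fin 3) :
    ∃ D : Fin 3 → E3 → ℝ,
      (∀ j, HasPartialOn (annulus R1 R2) j (velocityGrad R1 R2 α β i j) (D j)) ∧
      ∀ x ∈ annulus R1 R2, ∑ j, D j x =
        ∑ j, velocity R1 R2 α β j x * velocityGrad R1 R2 α β i j x +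
          pressureGrad R1 R2 α β i x := by
  have hA := fun j => hasPartialOn_angVel (R2 := R2) (α := α) hR1 j
  have hc := fun (j k : Fin 3) => HasPartialOn.coord (Ω := annulus R1 R2) (j := j) k
  have hw := fun j => hasPartialOn_inv_rhoSq (R2 := R2) hR1 j
  have hk := fun (j : Fin 3) (c : ℝ) => HasPartialOn.const (Ω := annulus R1 R2) (j := j) c
  have hq := fun (j k : Fin 3) => (hk j (swirl R1 R2 α)).mul ((hk j (R1 ^ 2)).mul
    ((hk j 2).mul ((hc j k).mul ((hw j).mul (hw j)))))
  have hb := fun (j k : Fin 3) => (hk j (β / 4)).mul (((hk j 2).mul (hc j k)).sub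
    ((hk j (logCoeff R1 R2)).mul ((hc j k).mul (hw j))))
  fin_cases i
  · refine exists_partials_sum_eq ((hc 0 1).mul (hq 0 0)).neg
      ((hA 1).add ((hc 1 1).mul (hq 1 1))).neg (hk 2 0) fun x hx => ?_
    have hs := (rhoSq_pos hR1 hx).ne'
    simp [velocity, velocityGrad, pressureGrad, Fin.sum_univ_three, angVel,
      -mul_eq_mul_left_iff]
    unfold rhoSq at *
    field_simp
    ring
  · refine exists_partials_sum_eq ((hA 0).add ((hc 0 0).mul (hq 0 0)))
      ((hc 1 0).mul (hq 1 1)) (hk 2 0) fun x hx => ?_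
    have hs := (rhoSq_pos hR1 hx).ne'
    simp [velocity, velocityGrad, pressureGrad, Fin.sum_univ_three, angVel,
      -mul_eq_mul_left_iff]
    unfold rhoSq at *
    field_simp
    ring
  · refine exists_partials_sum_eq (hb 0 0) (hb 1 1) (hk 2 0) fun x hx => ?_
    have hs := (rhoSq_pos hR1 hx).ne'
    simp [velocity, velocityGrad, pressureGrad, Fin.sum_univ_three, angVel,
      -mul_eq_mul_left_iff]
    unfold rhoSq at *
    field_simp
    ring

theorem memLp_top_velocity (hR1 : 0 < R1) (i : Fin 3) :
    MemLp (velocity R1 R2 α β i) ⊤ (volume.restrict (annulus R1 R2)) := by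
  refine BddOn.memLp_top isOpen_annulus ?_ (hasPartialOn_velocity hR1 i 0).continuousOn
  have k := fun c => BddOn.const (Ω := annulus R1 R2) c
  have x0 := bddOn_coord_zero (R2 := R2) hR1
  have x1 := bddOn_coord_one (R2 := R2) hR1
  have w := bddOn_inv_rhoSq (R2 := R2) hR1
  have A := (k (swirl R1 R2 α)).mul ((k 1).sub ((k (R1 ^ 2)).mul w))
  fin_cases i
  · exact (x1.mul A).neg
  · exact x0.mul A
  · exact (k (β / 4)).mul (((bddOn_rhoSq hR1).sub (k (R1 ^ 2))).sub ((k (logCoeff R1 R2)).mul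
      (((k (1 / 2)).mul (bddOn_log_rhoSq hR1)).sub (k (Real.log R1)))))

theorem memLp_top_velocityGrad (hR1 : 0 < R1) (i j : Fin 3) :
    MemLp (velocityGrad R1 R2 α β i j) ⊤ (volume.restrict (annulus R1 R2)) := by
  refine BddOn.memLp_top isOpen_annulus ?_ (hasPartialOn_velocity hR1 i j).cont
  have k := fun c => BddOn.const (Ω := annulus R1 R2) c
  have x0 := bddOn_coord_zero (R2 := R2) hR1
  have x1 := bddOn_coord_one (R2 := R2) hR1
  have w := bddOn_inv_rhoSq (R2 := R2) hR1
  have A := (k (swirl R1 R2 α)).mul ((k 1).sub ((k (R1 ^ 2)).mul w))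
  have q0 := (k (swirl R1 R2 α)).mul ((k (R1 ^ 2)).mul ((k 2).mul (x0.mul (w.mul w))))
  have q1 := (k (swirl R1 R2 α)).mul ((k (R1 ^ 2)).mul ((k 2).mul (x1.mul (w.mul w))))
  fin_cases i <;> fin_cases j
  · exact (x1.mul q0).neg
  · exact (A.add (x1.mul q1)).neg
  · exact k 0
  · exact A.add (x0.mul q0)
  · exact x0.mul q1
  · exact k 0
  · exact (k (β / 4)).mul (((k 2).mul x0).sub ((k (logCoeff R1 R2)).mul (x0.mul w)))
  · exact (k (β / 4)).mul (((k 2).mul x1).sub ((k (logCoeff R1 R2)).mul (x1.mul w)))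
  · exact k 0

/-- The spiral flow is a weak solution of the momentum equation. -/
theorem integral_spiral_eq_zero (hR1 : 0 < R1) {φ : Fin 3 → E3 → ℝ}
    (hφ : ∀ i, IsTest (annulus R1 R2) (φ i)) (i : Fin 3) :
    Integrable (fun x => (∑ j, velocityGrad R1 R2 α β i j x * pderiv j (φ i) x) +
      (∑ j, velocity R1 R2 α β j x * velocityGrad R1 R2 α β i j x) * φ i x -
      spiralP R1 R2 α β x * pderiv i (φ i) x) (volume.restrict (annulus R1 R2)) ∧
    ∫ x in annulus R1 R2, ((∑ j, velocityGrad R1 R2 α β i j x * pderiv j (φ i) x) +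
      (∑ j, velocity R1 R2 α β j x * velocityGrad R1 R2 α β i j x) * φ i x -
      spiralP R1 R2 α β x * pderiv i (φ i) x) = 0 := by
  obtain ⟨D, hD, hsum⟩ := exists_velocity_second_derivatives (R2 := R2) (α := α) (β := β) hR1 i
  have hU := fun i j => hasPartialOn_velocity (R2 := R2) (α := α) (β := β) hR1 i j
  have hP := hasPartialOn_pressure (R2 := R2) (α := α) (β := β) hR1 i
  have int := fun {f} (hf : ContinuousOn f (annulus R1 R2)) {ψ} (hψ : IsTest (annulus R1 R2) ψ) =>
    (hψ.integrable_continuousOn_mul isOpen_annulus hf).restrict (s := annulus R1 R2)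
  have hconv : ContinuousOn (fun x => ∑ j, velocity R1 R2 α β j x * velocityGrad R1 R2 α β i j x)
      (annulus R1 R2) :=
    continuousOn_finsetSum _ fun j _ => (hU j 0).continuousOn.mul (hU i j).cont
  have i1 := integrable_finsetSum (Finset.univ : Finset (Fin 3)) fun j _ =>
    int (hU i j).cont ((hφ i).pderiv j)
  have i2 := int hconv (hφ i)
  have i3 := int hP.continuousOn ((hφ i).pderiv i)
  have i12 : Integrable (fun x => (∑ j, velocityGrad R1 R2 α β i j x * pderiv j (φ i) x) +
      (∑ j, velocity R1 R2 α β j x * velocityGrad R1 R2 α β i j x) * φ i x)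
      (volume.restrict (annulus R1 R2)) := i1.add i2
  refine ⟨i12.sub i3, ?_⟩
  rw [integral_sub i12 i3, integral_add i1 i2,
    integral_finsetSum _ fun j _ => int (hU i j).cont ((hφ i).pderiv j),
    hP.integral_mul_pderiv isOpen_annulus (hφ i),
    Finset.sum_congr rfl fun j _ => (hD j).integral_mul_pderiv isOpen_annulus (hφ i),
    Finset.sum_neg_distrib, ← integral_finsetSum _ fun j _ => int (hD j).cont (hφ i)]
  have e : ∫ x in annulus R1 R2, ∑ j, D j x * φ i x =
      ∫ x in annulus R1 R2, ((∑ j, velocity R1 R2 α β j x * velocityGrad R1 R2 α β i j x) * φ i x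
        + pressureGrad R1 R2 α β i x * φ i x) := by
    refine setIntegral_congr_fun isOpen_annulus.measurableSet fun x hx => ?_
    rw [← Finset.sum_mul, hsum x hx, add_mul]
  rw [e, integral_add i2 (int hP.cont (hφ i))]
  ring

/-! ### The strain of the spiral flow -/

theorem le_half_logCoeff (hR1 : 0 < R1) (hR : R1 < R2) :
    R1 * R2 ≤ logCoeff R1 R2 / 2 := by
  have hR2 := hR1.trans hR
  have ht : 1 < R2 / R1 := (one_lt_div hR1).2 hR
  have hl : 0 < Real.log (R2 / R1) := Real.log_pos ht
  have h := Real.self_le_sinh_iff.2 hl.le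
  rw [Real.sinh_eq, Real.exp_neg, Real.exp_log (by positivity)] at h
  rw [logCoeff, div_div, le_div_iff₀ (by positivity)]
  have e : R1 * R2 * (2 * ((R2 / R1 - (R2 / R1)⁻¹) / 2)) = R2 ^ 2 - R1 ^ 2 := by
    field_simp
  rw [← e]
  exact mul_le_mul_of_nonneg_left (by linarith) (by positivity)

/-- With `K` the logarithmic coefficient, the size of the axial shear `ρ - K / (2 * ρ)` is largest
on the inner cylinder. -/
theorem abs_shear_le (hR1 : 0 < R1) {r : ℝ} (h1 : R1 < r) (h2 : r < R2) :
    |r - logCoeff R1 R2 / (2 * r)| ≤ logCoeff R1 R2 / (2 * R1) - R1 := by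
  have hK := le_half_logCoeff hR1 (h1.trans h2)
  have hr := hR1.trans h1
  have hR2 := hr.trans h2
  set K := logCoeff R1 R2 / 2
  have e : ∀ t, logCoeff R1 R2 / (2 * t) = K / t := fun t => by
    rw [← div_div]
  rw [e, e]
  have hK0 : 0 < K := (mul_pos hR1 hR2).trans_le hK
  have m : ∀ {a b : ℝ}, 0 < a → a ≤ b → K / b ≤ K / a := fun ha hab => by gcongr
  have a1 := m hR1 h1.le
  have a2 := m hr h2.le
  -- on the outer cylinder the shear has the opposite sign, and it is smaller there because
  -- `R1 * R2 ≤ K`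
  have a3 : R1 + R2 ≤ K / R1 + K / R2 := by
    rw [div_add_div _ _ hR1.ne' hR2.ne', le_div_iff₀ (by positivity)]
    nlinarith
  rw [abs_le]
  constructor <;> linarith

theorem Mflow_sq (R1 R2 α β : ℝ) : Mflow R1 R2 α β ^ 2 =
    swirl R1 R2 α ^ 2 + β ^ 2 / 16 * (logCoeff R1 R2 / (2 * R1) - R1) ^ 2 := by
  rw [Mflow, Real.sq_sqrt (by positivity), swirl, logCoeff, ← div_pow R2 R1, Real.log_pow]
  push_cast
  congr 1
  · rw [mul_pow, div_pow]
  · congr 3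
    rw [div_div]
    ring

theorem strain_quadratic_sq_le {w s X b P Q z m : ℝ} (hw : 0 < w) (hws : w * s = 1)
    (hm : X ^ 2 + b ^ 2 * s ≤ m) :
    (2 * P * (X * (w * Q) + b * z)) ^ 2 ≤ m * (w * P ^ 2 + (w * Q ^ 2 + z ^ 2)) ^ 2 := by
  have cs : (X * (w * Q) + b * z) ^ 2 ≤ (X ^ 2 + b ^ 2 * s) * (w * (w * Q ^ 2 + z ^ 2)) := by
    have : (X ^ 2 + b ^ 2 * s) * (w * (w * Q ^ 2 + z ^ 2)) - (X * (w * Q) + b * z) ^ 2 =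
        w * (X * z - b * Q) ^ 2 + (w * s - 1) * (b ^ 2 * (w * Q ^ 2 + z ^ 2)) := by ring
    rw [hws] at this
    nlinarith [mul_nonneg hw.le (sq_nonneg (X * z - b * Q))]
  have hs : 0 < s := pos_of_mul_pos_right (hws ▸ one_pos) hw.le
  have n2 : 0 ≤ w * Q ^ 2 + z ^ 2 := by positivity
  have n1 : 0 ≤ w * P ^ 2 := by positivity
  calc (2 * P * (X * (w * Q) + b * z)) ^ 2
      = 4 * P ^ 2 * (X * (w * Q) + b * z) ^ 2 := by ring
    _ ≤ 4 * P ^ 2 * ((X ^ 2 + b ^ 2 * s) * (w * (w * Q ^ 2 + z ^ 2))) := by gcongr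
    _ = (X ^ 2 + b ^ 2 * s) * (4 * (w * P ^ 2) * (w * Q ^ 2 + z ^ 2)) := by ring
    _ ≤ m * (w * P ^ 2 + (w * Q ^ 2 + z ^ 2)) ^ 2 := by
        have h0 : 0 ≤ X ^ 2 + b ^ 2 * s := by positivity
        refine mul_le_mul hm ?_ (by positivity) (h0.trans hm)
        nlinarith [sq_nonneg (w * P ^ 2 - (w * Q ^ 2 + z ^ 2))]

/-- The squares of the two components of the strain add up to at most `M ^ 2`. -/
theorem strain_components_le (hR1 : 0 < R1) {x : E3} (hx : x ∈ annulus R1 R2) :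
    (swirl R1 R2 α * (R1 ^ 2 * (rhoSq x)⁻¹)) ^ 2 +
      (β / 4 * (1 - logCoeff R1 R2 * (rhoSq x)⁻¹ / 2)) ^ 2 * rhoSq x ≤
        Mflow R1 R2 α β ^ 2 := by
  have hs := rhoSq_pos hR1 hx
  have hr : 0 < rho x := hR1.trans hx.1
  have hshear := abs_shear_le hR1 hx.1 hx.2
  rw [Mflow_sq]
  refine add_le_add ?_ ?_
  · have h1 : R1 ^ 2 * (rhoSq x)⁻¹ ≤ 1 := by
      rw [← div_eq_mul_inv, div_le_one hs]
      exact (sq_lt_rhoSq hR1 hx).le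
    rw [mul_pow]
    exact mul_le_of_le_one_right (sq_nonneg _) (pow_le_one₀ (by positivity) h1)
  · have e : (β / 4 * (1 - logCoeff R1 R2 * (rhoSq x)⁻¹ / 2)) ^ 2 * rhoSq x =
        β ^ 2 / 16 * (rho x - logCoeff R1 R2 / (2 * rho x)) ^ 2 := by
      rw [← rho_sq]
      field_simp
      ring
    rw [e]
    exact mul_le_mul_of_nonneg_left (sq_le_sq' (abs_le.1 hshear).1 (abs_le.1 hshear).2)
      (by positivity)

/-- The strain of the flow is bounded by `M` in the operator norm: it only couples the radial
direction to the other two, with coefficients that are largest on the inner cylinder. -/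
theorem abs_strain_le (hR1 : 0 < R1) {x : E3} (hx : x ∈ annulus R1 R2) (y : Fin 3 → ℝ) :
    |∑ i, ∑ j, velocityGrad R1 R2 α β i j x * (y j * y i)| ≤
      Mflow R1 R2 α β * ∑ i, y i ^ 2 := by
  have hM : 0 ≤ Mflow R1 R2 α β := Real.sqrt_nonneg _
  refine abs_le_of_sq_le_sq ?_ (mul_nonneg hM (Finset.sum_nonneg fun i _ => sq_nonneg _))
  have hs := rhoSq_pos hR1 hx
  have hws : (rhoSq x)⁻¹ * rhoSq x = 1 := inv_mul_cancel₀ hs.ne'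
  have hsum : ∑ i, ∑ j, velocityGrad R1 R2 α β i j x * (y j * y i) =
      2 * (x 0 * y 0 + x 1 * y 1) * (swirl R1 R2 α * (R1 ^ 2 * (rhoSq x)⁻¹) *
        ((rhoSq x)⁻¹ * (x 0 * y 1 - x 1 * y 0)) +
        β / 4 * (1 - logCoeff R1 R2 * (rhoSq x)⁻¹ / 2) * y 2) := by
    simp only [velocityGrad, Fin.sum_univ_three, Matrix.cons_val]
    ring
  have hN : ∑ i, y i ^ 2 = (rhoSq x)⁻¹ * (x 0 * y 0 + x 1 * y 1) ^ 2 +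
      ((rhoSq x)⁻¹ * (x 0 * y 1 - x 1 * y 0) ^ 2 + y 2 ^ 2) := by
    have : (rhoSq x)⁻¹ * (x 0 * y 0 + x 1 * y 1) ^ 2 +
        (rhoSq x)⁻¹ * (x 0 * y 1 - x 1 * y 0) ^ 2 =
          (rhoSq x)⁻¹ * rhoSq x * (y 0 ^ 2 + y 1 ^ 2) := by
      unfold rhoSq
      ring
    rw [← add_assoc, this, hws, Fin.sum_univ_three, one_mul]
  rw [hsum, hN, mul_pow (Mflow R1 R2 α β)]
  exact strain_quadratic_sq_le (inv_pos.2 hs) hws (strain_components_le hR1 hx)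

end Flow

/-! ### The energy identity -/

instance holderTriple_three_six_two : ENNReal.HolderTriple 3 6 2 where
  inv_add_inv_eq_inv := by
    rw [← ENNReal.toReal_eq_toReal_iff' (by simp) (by simp), ENNReal.toReal_add (by simp) (by simp)]
    simp only [ENNReal.toReal_inv, ENNReal.toReal_ofNat]
    norm_num

section Energy

/-- Transport by a solenoidal field is skew-symmetric on test functions. -/
theorem sum_integral_transport_eq_zero {Ω : Set E3} {u g : Fin 3 → E3 → ℝ}
    (hu : ∀ j, IsWeakPartial Ω j (u j) (g j))
    (hdiv : ∀ᵐ x ∂(volume.restrict Ω), ∑ j, g j x = 0) {φ : E3 → ℝ} (hφ : IsTest Ω φ) :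
    ∑ j, ∫ x in Ω, pderiv j φ x * (u j x * φ x) = 0 := by
  have h : ∀ j, ∫ x in Ω, pderiv j φ x * (u j x * φ x) = -∫ x in Ω, g j x * (φ x ^ 2 / 2) := by
    intro j
    rw [← (hu j).byParts _ hφ.half_sq]
    refine integral_congr_ae (Eventually.of_forall fun x => ?_)
    simp only [pderiv_half_sq hφ.differentiable]
    ring
  rw [Finset.sum_congr rfl fun j _ => h j, Finset.sum_neg_distrib, ← integral_finsetSum _
    fun j _ => integrable_mul_test_of_locallyIntegrableOn (hu j).locInt_deriv hφ.half_sq]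
  rw [integral_eq_zero_of_ae, neg_zero]
  filter_upwards [hdiv] with x hx
  rw [← Finset.sum_mul, hx, zero_mul, Pi.zero_apply]

variable {R1 R2 α β : ℝ} {v : E3 → E3} {q : E3 → ℝ} {H : Fin 3 → Fin 3 → E3 → ℝ}

theorem memLp_two_velocity_add_mul (hR1 : 0 < R1) {a f : E3 → ℝ}
    (ha : MemLp a 3 (volume.restrict (annulus R1 R2)))
    (h2 : MemLp f 2 (volume.restrict (annulus R1 R2)))
    (h6 : MemLp f 6 (volume.restrict (annulus R1 R2))) (j : Fin 3) :
    MemLp (fun x => (velocity R1 R2 α β j x + a x) * f x) 2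
      (volume.restrict (annulus R1 R2)) := by
  have h : MemLp (fun x => velocity R1 R2 α β j x * f x + a x * f x) 2
      (volume.restrict (annulus R1 R2)) := (h2.mul' (memLp_top_velocity hR1 j)).add (h6.mul' ha)
  simpa only [add_mul] using h

theorem IsV0.memLp_six (hH : IsV0 (annulus R1 R2) v H) (i : Fin 3) :
    MemLp (fun x => v x i) 6 (volume.restrict (annulus R1 R2)) := by
  obtain ⟨φ, h, h0, h1⟩ := (hH.h10 i).approx
  exact (tendsto_L6_of_tendsto_H1 (hH.h10 i).memL2 (hH.h10 i).memL2_grad h h0 h1).1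

theorem IsV0.memLp_three (hH : IsV0 (annulus R1 R2) v H) (i : Fin 3) :
    MemLp (fun x => v x i) 3 (volume.restrict (annulus R1 R2)) :=
  memLp_three_of_two_six (hH.h10 i).memL2 (hH.memLp_six i)

theorem hasPartialOn_spiralU (hR1 : 0 < R1) (i j : Fin 3) :
    HasPartialOn (annulus R1 R2) j (fun x => spiralU R1 R2 α β x i)
      (velocityGrad R1 R2 α β i j) :=
  (hasPartialOn_velocity hR1 i j).congr_left isOpen_annulus fun _ hx => spiralU_apply hR1 hx i

/-- The weak form of the equations satisfied by the perturbation `(v, q)`. -/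
theorem perturbation_weak_form (hR1 : 0 < R1) (hH : IsV0 (annulus R1 R2) v H)
    (hq : MemL2 (annulus R1 R2) q)
    (hsol : IsSolution R1 R2 α (fun x => spiralU R1 R2 α β x + v x)
      (fun x => spiralP R1 R2 α β x + q x))
    {φ : Fin 3 → E3 → ℝ} (hφ : ∀ i, IsTest (annulus R1 R2) (φ i)) :
    ∑ i, ((∑ j, ((∫ x in annulus R1 R2, H i j x * pderiv j (φ i) x) +
        (∫ x in annulus R1 R2, H i j x * ((velocity R1 R2 α β j x + v x j) * φ i x)) +
        ∫ x in annulus R1 R2, v x j * (velocityGrad R1 R2 α β i j x * φ i x))) -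
      ∫ x in annulus R1 R2, q x * pderiv i (φ i) x) = 0 := by
  obtain ⟨⟨G, -, -, -, hG, -, hweak⟩, -⟩ := hsol
  have hGH : ∀ᵐ x ∂(volume.restrict (annulus R1 R2)), ∀ i j,
      G i j x = velocityGrad R1 R2 α β i j x + H i j x := by
    refine ae_all_iff.2 fun i => ae_all_iff.2 fun j => ?_
    exact (hG i j).unique isOpen_annulus
      (((hasPartialOn_spiralU hR1 i j).isWeakPartial isOpen_annulus).add ((hH.h10 i).weak j))
  have hmem : ∀ᵐ x ∂(volume.restrict (annulus R1 R2)), x ∈ annulus R1 R2 :=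
    ae_restrict_mem isOpen_annulus.measurableSet
  have J1 : ∀ i j, Integrable (fun x => H i j x * pderiv j (φ i) x)
      (volume.restrict (annulus R1 R2)) := fun i j =>
    ((hH.h10 i).memL2_grad j).integrable_mul (((hφ i).pderiv j).memLp 2 _)
  have J2 : ∀ i j, Integrable (fun x => H i j x * ((velocity R1 R2 α β j x + v x j) * φ i x))
      (volume.restrict (annulus R1 R2)) := fun i j =>
    ((hH.h10 i).memL2_grad j).integrable_mul
      (memLp_two_velocity_add_mul hR1 (hH.memLp_three j) ((hφ i).memLp 2 _) ((hφ i).memLp 6 _) j)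
  have J3 : ∀ i j, Integrable (fun x => v x j * (velocityGrad R1 R2 α β i j x * φ i x))
      (volume.restrict (annulus R1 R2)) := fun i j =>
    (hH.h10 j).memL2.integrable_mul
      (((hφ i).memLp 2 _).mul' (r := 2) (memLp_top_velocityGrad hR1 i j))
  have J4 : ∀ i, Integrable (fun x => q x * pderiv i (φ i) x)
      (volume.restrict (annulus R1 R2)) := fun i =>
    hq.integrable_mul (((hφ i).pderiv i).memLp 2 _)
  have J12 : ∀ i j, Integrable (fun x => H i j x * pderiv j (φ i) x +
      H i j x * ((velocity R1 R2 α β j x + v x j) * φ i x))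
      (volume.restrict (annulus R1 R2)) := fun i j => (J1 i j).add (J2 i j)
  have J123 : ∀ i j, Integrable (fun x => H i j x * pderiv j (φ i) x +
      H i j x * ((velocity R1 R2 α β j x + v x j) * φ i x) +
      v x j * (velocityGrad R1 R2 α β i j x * φ i x))
      (volume.restrict (annulus R1 R2)) := fun i j => (J12 i j).add (J3 i j)
  have JS : ∀ i, Integrable (fun x => ∑ j, (H i j x * pderiv j (φ i) x +
      H i j x * ((velocity R1 R2 α β j x + v x j) * φ i x) +
      v x j * (velocityGrad R1 R2 α β i j x * φ i x)))
      (volume.restrict (annulus R1 R2)) := fun i => integrable_finsetSum _ fun j _ => J123 i j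
  have JT : ∀ i, Integrable (fun x => (∑ j, (H i j x * pderiv j (φ i) x +
      H i j x * ((velocity R1 R2 α β j x + v x j) * φ i x) +
      v x j * (velocityGrad R1 R2 α β i j x * φ i x))) - q x * pderiv i (φ i) x)
      (volume.restrict (annulus R1 R2)) := fun i => (JS i).sub (J4 i)
  have hS := fun i => integral_spiral_eq_zero (R2 := R2) (α := α) (β := β) hR1 hφ i
  have hw := hweak φ hφ
  rw [integral_congr_ae (g := fun x => ∑ i, (((∑ j, (H i j x * pderiv j (φ i) x +
      H i j x * ((velocity R1 R2 α β j x + v x j) * φ i x) +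
      v x j * (velocityGrad R1 R2 α β i j x * φ i x))) - q x * pderiv i (φ i) x) +
      ((∑ j, velocityGrad R1 R2 α β i j x * pderiv j (φ i) x) +
      (∑ j, velocity R1 R2 α β j x * velocityGrad R1 R2 α β i j x) * φ i x -
      spiralP R1 R2 α β x * pderiv i (φ i) x)))] at hw
  · rw [integral_finsetSum] at hw
    swap
    · exact fun i _ => (JT i).add (hS i).1
    rw [← hw]
    refine Finset.sum_congr rfl fun i _ => ?_
    rw [integral_add (JT i) (hS i).1, (hS i).2, add_zero, integral_sub (JS i) (J4 i),
      integral_finsetSum _ fun j _ => J123 i j]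
    congr 1
    refine Finset.sum_congr rfl fun j _ => ?_
    rw [integral_add (J12 i j) (J3 i j), integral_add (J1 i j) (J2 i j)]
  · filter_upwards [hGH, hmem] with x hx hxΩ
    simp only [hx, PiLp.add_apply, spiralU_apply hR1 hxΩ, Fin.sum_univ_three]
    ring

/-- The energy identity: the convective term and the pressure drop out when the equations are
tested with `v` itself. Testing is done with the test functions approximating `v`; they need not
be solenoidal, since only the limit of their divergences enters. -/
theorem energy_identity (hR1 : 0 < R1) (hH : IsV0 (annulus R1 R2) v H)
    (hq : MemL2 (annulus R1 R2) q)
    (hsol : IsSolution R1 R2 α (fun x => spiralU R1 R2 α β x + v x)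
      (fun x => spiralP R1 R2 α β x + q x)) :
    ∑ i, ∑ j, ((∫ x in annulus R1 R2, H i j x * H i j x) +
      ∫ x in annulus R1 R2, v x j * (velocityGrad R1 R2 α β i j x * v x i)) = 0 := by
  choose φ hφ hφ0 hφ1 using fun i => (hH.h10 i).approx
  have h2 := fun i => (hH.h10 i).memL2
  have hg := fun i j => (hH.h10 i).memL2_grad j
  have h6 := hH.memLp_six
  have h3 := hH.memLp_three
  have hφ6 := fun i => (tendsto_L6_of_tendsto_H1 (h2 i) (hg i) (hφ i) (hφ0 i) (hφ1 i)).2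
  have cu : ∀ i j, Tendsto (fun n => eLpNorm
      ((fun x => (velocity R1 R2 α β j x + v x j) * φ i n x) -
        fun x => (velocity R1 R2 α β j x + v x j) * v x i) 2
      (volume.restrict (annulus R1 R2))) atTop (𝓝 0) := by
    intro i j
    have t1 := tendsto_eLpNorm_mul_sub (r := 2) (memLp_top_velocity (R2 := R2) (α := α) (β := β)
      hR1 j) (fun n => (hφ i n).memLp 2 _) (h2 i) (hφ0 i)
    have t2 := tendsto_eLpNorm_mul_sub (r := 2) (h3 j) (fun n => (hφ i n).memLp 6 _) (h6 i) (hφ6 i)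
    refine tendsto_of_tendsto_of_tendsto_of_le_of_le tendsto_const_nhds
      (by simpa using t1.add t2) (fun _ => bot_le) fun n => ?_
    have m1 := (((hφ i n).memLp 2 (volume.restrict (annulus R1 R2))).mul (r := 2)
      (memLp_top_velocity (α := α) (β := β) hR1 j)).sub ((h2 i).mul
        (memLp_top_velocity (α := α) (β := β) hR1 j))
    have m2 := ((((hφ i n).memLp 6 (volume.restrict (annulus R1 R2))).mul (r := 2) (h3 j))).sub
      ((h6 i).mul (h3 j))
    refine le_trans (le_of_eq ?_) (eLpNorm_add_le m1.1 m2.1 (by norm_num))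
    congr 1
    ext x
    simp only [Pi.sub_apply, Pi.add_apply, Pi.mul_apply]
    ring
  have cg : ∀ i j, Tendsto (fun n => eLpNorm ((velocityGrad R1 R2 α β i j * φ i n) -
      velocityGrad R1 R2 α β i j * fun x => v x i) 2
      (volume.restrict (annulus R1 R2))) atTop (𝓝 0) := fun i j =>
    tendsto_eLpNorm_mul_sub (memLp_top_velocityGrad hR1 i j) (fun n => (hφ i n).memLp 2 _)
      (h2 i) (hφ0 i)
  have cc : ∀ f : E3 → ℝ, Tendsto (fun _ : ℕ => eLpNorm (f - f) 2
      (volume.restrict (annulus R1 R2))) atTop (𝓝 0) := fun f => by simp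
  have mu : ∀ i j n, MemLp (fun x => (velocity R1 R2 α β j x + v x j) * φ i n x) 2
      (volume.restrict (annulus R1 R2)) := fun i j n =>
    memLp_two_velocity_add_mul hR1 (h3 j) ((hφ i n).memLp 2 _) ((hφ i n).memLp 6 _) j
  have muv : ∀ i j, MemLp (fun x => (velocity R1 R2 α β j x + v x j) * v x i) 2
      (volume.restrict (annulus R1 R2)) := fun i j =>
    memLp_two_velocity_add_mul hR1 (h3 j) (h2 i) (h6 i) j
  have md : ∀ i j n, MemLp (pderiv j (φ i n)) 2 (volume.restrict (annulus R1 R2)) :=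
    fun i j n => ((hφ i n).pderiv j).memLp 2 _
  -- the convective term
  have hskew : ∀ i, ∑ j, ∫ x in annulus R1 R2,
      H i j x * ((velocity R1 R2 α β j x + v x j) * v x i) = 0 := by
    intro i
    have hlim := tendsto_finsetSum (Finset.univ : Finset (Fin 3)) fun j _ =>
      tendsto_integral_mul_of_L2 (md i j) (mu i j) (hg i j) (muv i j) (hφ1 i j) (cu i j)
    refine tendsto_nhds_unique hlim (tendsto_const_nhds.congr fun n => ?_)
    refine (sum_integral_transport_eq_zero (g := fun j x => velocityGrad R1 R2 α β j j x + H j j x)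
      (u := fun j x => velocity R1 R2 α β j x + v x j) (fun j =>
      ((hasPartialOn_velocity hR1 j j).isWeakPartial isOpen_annulus).add ((hH.h10 j).weak j))
      ?_ (hφ i n)).symm
    filter_upwards [hH.divFree] with x hx
    rw [Finset.sum_add_distrib, hx, add_zero]
    simp only [velocityGrad, Fin.sum_univ_three, Matrix.cons_val]
    ring
  -- the pressure term
  have hpress : ∑ i, ∫ x in annulus R1 R2, q x * H i i x = 0 := by
    have I : ∀ i, Integrable (fun x => q x * H i i x) (volume.restrict (annulus R1 R2)) :=
      fun i => hq.integrable_mul (hg i i)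
    rw [← integral_finsetSum _ fun i _ => I i]
    refine integral_eq_zero_of_ae ?_
    filter_upwards [hH.divFree] with x hx
    rw [← Finset.mul_sum, hx, mul_zero, Pi.zero_apply]
  have hlim := tendsto_finsetSum (Finset.univ : Finset (Fin 3)) fun i _ =>
    (tendsto_finsetSum (Finset.univ : Finset (Fin 3)) fun j _ =>
      ((tendsto_integral_mul_of_L2 (fun _ => hg i j) (md i j) (hg i j) (hg i j) (cc _)
        (hφ1 i j)).add
      (tendsto_integral_mul_of_L2 (fun _ => hg i j) (mu i j) (hg i j) (muv i j) (cc _)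
        (cu i j))).add
      (tendsto_integral_mul_of_L2 (fun _ => h2 j)
        (fun n => ((hφ i n).memLp 2 _).mul (memLp_top_velocityGrad hR1 i j)) (h2 j)
        ((h2 i).mul (memLp_top_velocityGrad hR1 i j)) (cc _) (cg i j))).sub
      (tendsto_integral_mul_of_L2 (fun _ => hq) (md i i) hq (hg i i) (cc _) (hφ1 i i))
  have h0 := tendsto_nhds_unique hlim (tendsto_const_nhds.congr fun n =>
    (perturbation_weak_form (φ := fun i => φ i n) hR1 hH hq hsol fun i => hφ i n).symm)
  simp only [Finset.sum_sub_distrib, Finset.sum_add_distrib, hskew, hpress,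
    add_zero, sub_zero, Pi.mul_apply] at h0
  simpa only [Finset.sum_add_distrib] using h0

/-- The energy inequality: the strain of the flow controls the dissipation of `v`. -/
theorem energy_inequality (hR1 : 0 < R1) (hH : IsV0 (annulus R1 R2) v H)
    (hq : MemL2 (annulus R1 R2) q)
    (hsol : IsSolution R1 R2 α (fun x => spiralU R1 R2 α β x + v x)
      (fun x => spiralP R1 R2 α β x + q x)) :
    ∫ x in annulus R1 R2, ∑ i, ∑ j, H i j x ^ 2 ≤
      Mflow R1 R2 α β * ∫ x in annulus R1 R2, ‖v x‖ ^ 2 := by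
  have h2 := fun i => (hH.h10 i).memL2
  have hg := fun i j => (hH.h10 i).memL2_grad j
  have I1 : ∀ i j, Integrable (fun x => H i j x ^ 2) (volume.restrict (annulus R1 R2)) :=
    fun i j => (hg i j).integrable_sq
  have I2 : ∀ i j, Integrable (fun x => v x j * (velocityGrad R1 R2 α β i j x * v x i))
      (volume.restrict (annulus R1 R2)) := fun i j =>
    (h2 j).integrable_mul ((h2 i).mul' (r := 2) (memLp_top_velocityGrad hR1 i j))
  have I3 : Integrable (fun x => ∑ i, v x i ^ 2) (volume.restrict (annulus R1 R2)) :=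
    integrable_finsetSum _ fun i _ => (h2 i).integrable_sq
  have I22 : Integrable (fun x => ∑ i, ∑ j, v x j * (velocityGrad R1 R2 α β i j x * v x i))
      (volume.restrict (annulus R1 R2)) :=
    integrable_finsetSum _ fun i _ => integrable_finsetSum _ fun j _ => I2 i j
  have hE := energy_identity hR1 hH hq hsol
  have e1 : ∫ x in annulus R1 R2, ∑ i, ∑ j, H i j x ^ 2 =
      ∑ i, ∑ j, ∫ x in annulus R1 R2, H i j x * H i j x := by
    rw [integral_finsetSum _ fun i _ => integrable_finsetSum _ fun j _ => I1 i j]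
    refine Finset.sum_congr rfl fun i _ => ?_
    rw [integral_finsetSum _ fun j _ => I1 i j]
    simp only [sq]
  have e2 : ∫ x in annulus R1 R2, ∑ i, ∑ j, v x j * (velocityGrad R1 R2 α β i j x * v x i) =
      ∑ i, ∑ j, ∫ x in annulus R1 R2, v x j * (velocityGrad R1 R2 α β i j x * v x i) := by
    rw [integral_finsetSum _ fun i _ => integrable_finsetSum _ fun j _ => I2 i j]
    exact Finset.sum_congr rfl fun i _ => integral_finsetSum _ fun j _ => I2 i j
  simp only [Finset.sum_add_distrib] at hE
  rw [← e1, ← e2] at hE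
  have e3 : ∀ x, ‖v x‖ ^ 2 = ∑ i, v x i ^ 2 := fun x => by
    simp [EuclideanSpace.norm_sq_eq]
  simp only [e3]
  rw [← integral_const_mul]
  calc ∫ x in annulus R1 R2, ∑ i, ∑ j, H i j x ^ 2
      = ∫ x in annulus R1 R2, -∑ i, ∑ j, v x j * (velocityGrad R1 R2 α β i j x * v x i) := by
        rw [integral_neg]; linarith
    _ ≤ ∫ x in annulus R1 R2, Mflow R1 R2 α β * ∑ i, v x i ^ 2 := by
        refine setIntegral_mono_on I22.neg (I3.const_mul _) isOpen_annulus.measurableSet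
          fun x hx => (neg_le_abs _).trans ?_
        refine le_trans (le_of_eq ?_) (abs_strain_le (α := α) (β := β) hR1 hx fun i => v x i)
        congr 1
        refine Finset.sum_congr rfl fun i _ => Finset.sum_congr rfl fun j _ => ?_
        ring

/-- The Poincaré inequality with constant `Λ`. -/
theorem Lambda_mul_le {Ω : Set E3} (hH : IsV0 Ω v H) :
    Lambda Ω * ∫ x in Ω, ‖v x‖ ^ 2 ≤ ∫ x in Ω, ∑ i, ∑ j, H i j x ^ 2 := by
  have hn : 0 ≤ ∫ x in Ω, ‖v x‖ ^ 2 := integral_nonneg fun x => sq_nonneg _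
  have hd : ∀ (H : Fin 3 → Fin 3 → E3 → ℝ), 0 ≤ ∫ x in Ω, ∑ i, ∑ j, H i j x ^ 2 := fun H =>
    integral_nonneg fun x => Finset.sum_nonneg fun i _ => Finset.sum_nonneg fun j _ => sq_nonneg _
  rcases hn.eq_or_lt with h0 | hpos
  · rw [← h0, mul_zero]
    exact hd H
  rw [← le_div_iff₀ hpos]
  refine csInf_le ⟨0, ?_⟩ ⟨v, H, hH, fun h => hpos.ne' ?_, rfl⟩
  · rintro r ⟨w, K, -, -, rfl⟩
    exact div_nonneg (hd K) (integral_nonneg fun x => sq_nonneg _)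
  · refine integral_eq_zero_of_ae ?_
    filter_upwards [h] with x hx
    simp [hx]

theorem IsV0.ae_eq_zero_of_integral_le {Ω : Set E3} (hH : IsV0 Ω v H)
    (h : ∫ x in Ω, ‖v x‖ ^ 2 ≤ 0) : v =ᵐ[volume.restrict Ω] 0 := by
  have e3 : ∀ x, ‖v x‖ ^ 2 = ∑ i, v x i ^ 2 := fun x => by
    simp [EuclideanSpace.norm_sq_eq]
  have I : Integrable (fun x => ‖v x‖ ^ 2) (volume.restrict Ω) := by
    simp only [e3]
    exact integrable_finsetSum _ fun i _ => (hH.h10 i).memL2.integrable_sq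
  have := (integral_eq_zero_iff_of_nonneg (fun x => sq_nonneg _) I).1
    (h.antisymm (integral_nonneg fun x => sq_nonneg _))
  filter_upwards [this] with x hx
  simpa using hx

end Energy

/-! ### The pressure -/

section Pressure

variable {R1 R2 : ℝ}

theorem rho_sub_smul_single (x : E3) (t : ℝ) :
    rho (x - t • EuclideanSpace.single 2 (1 : ℝ)) = rho x := by
  simp [rho]

theorem IsTest.translate {ψ : E3 → ℝ} (hψ : IsTest (annulus R1 R2) ψ) (t : ℝ) :
    IsTest (annulus R1 R2) (fun x => ψ (x - t • EuclideanSpace.single 2 (1 : ℝ))) := by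
  refine ⟨hψ.smooth.comp (contDiff_id.sub contDiff_const), ?_, ?_⟩
  · exact hψ.compact.comp_homeomorph (Homeomorph.subRight _)
  · intro x hx
    have h := hψ.support (tsupport_comp_subset_preimage ψ
      (f := fun x : E3 => x - t • EuclideanSpace.single 2 (1 : ℝ)) (by fun_prop) hx)
    exact ⟨by simpa only [rho_sub_smul_single] using h.1,
      by simpa only [rho_sub_smul_single] using h.2⟩

theorem pderiv_translate {ψ : E3 → ℝ} (j : Fin 3) (e x : E3) :
    pderiv j (fun x => ψ (x - e)) x = pderiv j ψ (x - e) := by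
  rw [pderiv, pderiv, fderiv_comp_sub]

/-- If the vertical derivative of `q` vanishes, then the integral of `q` against a test function
does not change when the test function is translated vertically. -/
theorem integral_mul_translate_eq {q : E3 → ℝ} (hq : MemL2 (annulus R1 R2) q)
    (h : ∀ ψ, IsTest (annulus R1 R2) ψ → ∫ x in annulus R1 R2, q x * pderiv 2 ψ x = 0)
    {ψ : E3 → ℝ} (hψ : IsTest (annulus R1 R2) ψ) (t : ℝ) :
    ∫ x in annulus R1 R2, q x * ψ (x - t • EuclideanSpace.single 2 (1 : ℝ)) =
      ∫ x in annulus R1 R2, q x * ψ x := by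
  have hm := (isOpen_annulus (R1 := R1) (R2 := R2)).measurableSet
  set e : E3 := EuclideanSpace.single 2 (1 : ℝ) with he
  set Q : E3 → ℝ := (annulus R1 R2).indicator q with hQ
  have hQl : LocallyIntegrable Q := ((memLp_indicator_iff_restrict hm).2 hq).locallyIntegrable
    (by norm_num)
  have hset : ∀ f : E3 → ℝ, ∫ x in annulus R1 R2, q x * f x = ∫ x, Q x * f x := by
    intro f
    rw [← integral_indicator hm]
    congr 1
    ext x
    by_cases hx : x ∈ annulus R1 R2 <;> simp [hQ, hx]
  -- the translated integral is a convolution with the reflected test function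
  set ψ' : E3 → ℝ := fun x => ψ (-x) with hψ'
  have hψ'c : HasCompactSupport ψ' := hψ.compact.comp_homeomorph (Homeomorph.neg E3)
  have hψ's : ContDiff ℝ 1 ψ' := (hψ.smooth.comp contDiff_neg).of_le (by simp)
  set F : E3 → ℝ := convolution Q ψ' (ContinuousLinearMap.lsmul ℝ ℝ) volume with hF
  have hFd := fun y => hψ'c.hasFDerivAt_convolution_right (ContinuousLinearMap.lsmul ℝ ℝ) hQl hψ's y
  have hFv : ∀ s : ℝ, F (s • e) = ∫ x in annulus R1 R2, q x * ψ (x - s • e) := by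
    intro s
    rw [hset, hF, convolution_def]
    simp [hψ']
  have hder : ∀ s : ℝ, HasDerivAt (fun s : ℝ => F (s • e)) 0 s := by
    intro s
    have h1 : HasDerivAt (fun s : ℝ => s • e) e s := by
      simpa using (hasDerivAt_id s).smul_const e
    have h2 := (hFd (s • e)).comp_hasDerivAt s h1
    suffices h0 : convolution Q (fderiv ℝ ψ')
        ((ContinuousLinearMap.lsmul ℝ ℝ : ℝ →L[ℝ] ℝ →L[ℝ] ℝ).precompR E3) volume (s • e) e = 0 by
      rw [h0] at h2
      exact h2
    rw [convolution_precompR_apply _ hQl (hψ'c.fderiv (𝕜 := ℝ)) (hψ's.continuous_fderiv (by simp)),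
      convolution_def]
    have h3 := h _ (hψ.translate s)
    rw [hset] at h3
    rw [← neg_zero, ← h3, ← integral_neg]
    congr 1
    ext x
    have h4 : fderiv ℝ ψ' (s • e - x) e = -fderiv ℝ ψ (x - s • e) e := by
      have h5 := ((hψ.differentiable (-(s • e - x))).hasFDerivAt.comp (s • e - x)
        (hasFDerivAt_id (𝕜 := ℝ) (s • e - x)).neg).fderiv
      rw [show ψ' = ψ ∘ Neg.neg from rfl, h5]
      simp
    rw [pderiv_translate, pderiv, ← he, ← mul_neg, ← h4]
    rfl
  have hconst := is_const_of_deriv_eq_zero (fun s => (hder s).differentiableAt)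
    (fun s => (hder s).deriv) t 0
  simp only [hFv] at hconst
  simpa using hconst

theorem tendsto_integral_upper {q : E3 → ℝ} (hq : MemL2 (annulus R1 R2) q) (C : ℝ) :
    Tendsto (fun n : ℕ => ∫ x in {x : E3 | (n : ℝ) - C ≤ x 2}, q x ^ 2
      ∂(volume.restrict (annulus R1 R2))) atTop (𝓝 0) := by
  have hcont : Continuous fun x : E3 => x 2 := by fun_prop
  have := tendsto_setIntegral_of_antitone (μ := volume.restrict (annulus R1 R2))
    (f := fun x => q x ^ 2) (s := fun n : ℕ => {x : E3 | (n : ℝ) - C ≤ x 2})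
    (fun n => (isClosed_le continuous_const hcont).measurableSet)
    (fun n m hnm x hx => by
      have : (n : ℝ) ≤ m := by exact_mod_cast hnm
      simp only [Set.mem_ofPred_eq] at hx ⊢
      linarith)
    ⟨0, hq.integrable_sq.integrableOn⟩
  have e : (⋂ n : ℕ, {x : E3 | (n : ℝ) - C ≤ x 2}) = ∅ := by
    refine Set.eq_empty_iff_forall_notMem.2 fun x hx => ?_
    obtain ⟨n, hn⟩ := exists_nat_gt (x 2 + C)
    have := Set.mem_iInter.1 hx n
    simp only [Set.mem_ofPred_eq] at this
    linarith
  rwa [e, setIntegral_empty] at this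

/-- A square integrable function on the annulus whose vertical derivative vanishes is zero:
test functions can be moved to infinity, where the mass of `q` is small. -/
theorem ae_eq_zero_of_vertical_derivative {q : E3 → ℝ} (hq : MemL2 (annulus R1 R2) q)
    (h : ∀ ψ, IsTest (annulus R1 R2) ψ → ∫ x in annulus R1 R2, q x * pderiv 2 ψ x = 0) :
    q =ᵐ[volume.restrict (annulus R1 R2)] 0 := by
  have hm := (isOpen_annulus (R1 := R1) (R2 := R2)).measurableSet
  have hloc : LocallyIntegrableOn q (annulus R1 R2) :=
    locallyIntegrableOn_of_locallyIntegrable_restrict (hq.locallyIntegrable (by norm_num))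
  refine ae_eq_zero_of_forall_test isOpen_annulus hloc fun ψ hψ => ?_
  obtain ⟨C, hC⟩ := (hψ.compact.isCompact.image (f := fun x : E3 => x 2) (by fun_prop)).bddBelow
  set B := ∫ x, ψ x ^ 2 with hB
  set c := ∫ x in annulus R1 R2, q x * ψ x with hc
  have key : ∀ δ : ℝ, 0 < δ → |c| ≤ δ * B := by
    intro δ hδ
    have lim : Tendsto (fun n : ℕ => δ * B + δ⁻¹ * ∫ x in {x : E3 | (n : ℝ) - (-C) ≤ x 2}, q x ^ 2
      ∂(volume.restrict (annulus R1 R2))) atTop (𝓝 (δ * B + δ⁻¹ * 0)) :=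
      tendsto_const_nhds.add ((tendsto_integral_upper hq _).const_mul _)
    rw [mul_zero, add_zero] at lim
    refine ge_of_tendsto' lim fun n => ?_
    have ht := hψ.translate (n : ℝ)
    set S := {x : E3 | (n : ℝ) - (-C) ≤ x 2} with hS
    have hSm : MeasurableSet S := (isClosed_le continuous_const (by fun_prop)).measurableSet
    set ψn : E3 → ℝ := fun x => ψ (x - (n : ℝ) • EuclideanSpace.single 2 (1 : ℝ)) with hψn
    have hBn : ∫ x in annulus R1 R2, ψn x ^ 2 ≤ B := by
      rw [hB, ← integral_sub_right_eq_self (fun x => ψ x ^ 2)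
        ((n : ℝ) • EuclideanSpace.single 2 (1 : ℝ))]
      exact setIntegral_le_integral (ht.memLp 2 volume).integrable_sq
        (Eventually.of_forall fun x => sq_nonneg _)
    have hz : ∀ x, x ∉ S → ψn x = 0 := by
      intro x hx
      by_contra hne
      have h1 := hC ⟨_, subset_tsupport ψ hne, rfl⟩
      refine hx ?_
      simp at h1
      simp only [hS, Set.mem_ofPred_eq]
      linarith
    have hqS := hq.integrable_sq.indicator hSm
    have hψi := (ht.memLp 2 (volume.restrict (annulus R1 R2))).integrable_sq
    calc |c| = |∫ x in annulus R1 R2, q x * ψn x| := by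
          rw [hc, ← integral_mul_translate_eq hq h hψ n]
      _ ≤ ∫ x in annulus R1 R2, |q x * ψn x| := abs_integral_le_integral_abs
      _ ≤ ∫ x in annulus R1 R2, (δ * ψn x ^ 2 + δ⁻¹ * S.indicator (fun x => q x ^ 2) x) := by
          refine integral_mono (hq.integrable_mul (ht.memLp 2 _)).abs
            ((hψi.const_mul δ).add (hqS.const_mul δ⁻¹)) fun x => ?_
          by_cases hx : x ∈ S
          · simp only [Set.indicator_of_mem hx]
            rw [abs_mul, ← sq_abs (ψn x), ← sq_abs (q x)]
            have e : δ * |ψn x| ^ 2 + δ⁻¹ * |q x| ^ 2 - |q x| * |ψn x| =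
                δ⁻¹ * ((δ * |ψn x| - |q x| / 2) ^ 2 + 3 / 4 * |q x| ^ 2) := by
              field_simp
              ring
            have : 0 ≤ δ⁻¹ * ((δ * |ψn x| - |q x| / 2) ^ 2 + 3 / 4 * |q x| ^ 2) := by positivity
            linarith
          · simp [hz x hx, Set.indicator_of_notMem hx]
      _ = δ * (∫ x in annulus R1 R2, ψn x ^ 2) +
            δ⁻¹ * ∫ x in S, q x ^ 2 ∂(volume.restrict (annulus R1 R2)) := by
          rw [integral_add (hψi.const_mul δ) (hqS.const_mul δ⁻¹), integral_const_mul,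
            integral_const_mul, integral_indicator hSm]
      _ ≤ _ := by gcongr
  have hB0 : 0 ≤ B := integral_nonneg fun x => sq_nonneg _
  by_contra hne
  have hpos : 0 < |c| := abs_pos.2 hne
  have := key (|c| / (2 * (B + 1))) (by positivity)
  rw [div_mul_eq_mul_div, le_div_iff₀ (by positivity)] at this
  nlinarith

end Pressure

/-- When the velocity perturbation vanishes, so does the pressure perturbation. -/
theorem pressure_ae_eq_zero {R1 R2 α β : ℝ} {v : E3 → E3} {q : E3 → ℝ}
    {H : Fin 3 → Fin 3 → E3 → ℝ} (hR1 : 0 < R1) (hH : IsV0 (annulus R1 R2) v H)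
    (hq : MemL2 (annulus R1 R2) q)
    (hsol : IsSolution R1 R2 α (fun x => spiralU R1 R2 α β x + v x)
      (fun x => spiralP R1 R2 α β x + q x))
    (hv : v =ᵐ[volume.restrict (annulus R1 R2)] 0) :
    q =ᵐ[volume.restrict (annulus R1 R2)] 0 := by
  have hH0 : ∀ i j, H i j =ᵐ[volume.restrict (annulus R1 R2)] 0 := by
    intro i j
    refine ae_eq_zero_of_forall_test isOpen_annulus ((hH.h10 i).weak j).locInt_deriv
      fun φ hφ => ?_
    have h1 := ((hH.h10 i).weak j).byParts φ hφ
    rw [integral_eq_zero_of_ae (by filter_upwards [hv] with x hx; simp [hx])] at h1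
    linarith
  refine ae_eq_zero_of_vertical_derivative hq fun ψ hψ => ?_
  have h := perturbation_weak_form (φ := ![fun _ => 0, fun _ => 0, ψ]) hR1 hH hq hsol
    (fun i => by fin_cases i; exacts [isTest_zero, isTest_zero, hψ])
  have z : ∀ f g : E3 → ℝ, f =ᵐ[volume.restrict (annulus R1 R2)] 0 →
      ∫ x in annulus R1 R2, f x * g x = 0 := by
    intro f g hf
    refine integral_eq_zero_of_ae ?_
    filter_upwards [hf] with x hx
    simp [hx]
  have zv : ∀ j, (fun x => v x j) =ᵐ[volume.restrict (annulus R1 R2)] 0 := fun j => by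
    filter_upwards [hv] with x hx
    simp [hx]
  simp only [z _ _ (hH0 _ _), fun j g => z (fun x => v x j) g (zv j)] at h
  simpa [Fin.sum_univ_three, pderiv_zero] using h

end CouettePoiseuille

end

theorem theorem3p5 (R1 R2 α β : ℝ) (hR1 : 0 < R1) (hR : R1 < R2)
    (v : CouettePoiseuille.E3 → CouettePoiseuille.E3) (q : CouettePoiseuille.E3 → ℝ)
    (hv : CouettePoiseuille.MemV0 (CouettePoiseuille.annulus R1 R2) v)
    (hq : CouettePoiseuille.MemL2 (CouettePoiseuille.annulus R1 R2) q)
    (hsol : CouettePoiseuille.IsSolution R1 R2 α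
      (fun x => CouettePoiseuille.spiralU R1 R2 α β x + v x)
      (fun x => CouettePoiseuille.spiralP R1 R2 α β x + q x))
    (hM : CouettePoiseuille.Mflow R1 R2 α β <
      CouettePoiseuille.Lambda (CouettePoiseuille.annulus R1 R2)) :
    v =ᵐ[volume.restrict (CouettePoiseuille.annulus R1 R2)] 0 ∧
      q =ᵐ[volume.restrict (CouettePoiseuille.annulus R1 R2)] 0 := by
  obtain ⟨H, hH⟩ := hv
  have h1 := CouettePoiseuille.Lambda_mul_le hH
  have h2 := CouettePoiseuille.energy_inequality hR1 hH hq hsol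
  have hv0 : v =ᵐ[volume.restrict (CouettePoiseuille.annulus R1 R2)] 0 :=
    hH.ae_eq_zero_of_integral_le (by nlinarith)
  exact ⟨hv0, CouettePoiseuille.pressure_ae_eq_zero hR1 hH hq hsol hv0⟩
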